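/- Let $\mathbb K$ be an algebraically closed field of characteristic zero and let $\mathcal C$ be a finite tensor category over $\mathbb K$, i.e. a rigid monoidal abelian $\mathbb K$-linear category with bilinear tensor product and simple unit object, which is equivalent as a linear category to the category of finite-dimensional modules over a finite-dimensional $\mathbb K$-algebra. For an algebra $A$ in $\mathcal C$ let $\mathrm{Mod}_A(\mathcal C)$ be the left $\mathcal C$-module category of right $A$-modules in $\mathcal C$. A $\mathcal C$-module category $\mathcal M$ is exact if $P\otimes M$ is projective for every projective $P\in\mathcal C$ and every $M\in\mathcal M$, and indecomposable if it is not equivalent to a direct sum of two nonzero $\mathcal C$-module categories; $A$ is called exact (indecomposable) if $\mathrm{Mod}_A(\mathcal C)$ is. Let $L$ be an exact algebra in $\mathcal C$. Then there are a finite set $I$ and nonzero exact indecomposable algebras $L_i$ $(i\in I)$ in $\mathcal C$ such that: (i) $L\cong\prod_{i\in I}L_i$ as algebras in $\mathcal C$. (ii) There is an equivalence of $\mathbb K$-linear $\mathcal C$-module categories $\mathrm{Mod}_L(\mathcal C)\simeq\bigoplus_{i\in I}\mathrm{Mod}_{L_i}(\mathcal C)$. (iii) There is a $\mathbb K$-linear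 equivalence ${}_L\mathrm{Bimod}_L(\mathcal C)\simeq\bigoplus_{i,j\in I}{}_{L_i}\mathrm{Bimod}_{L_j}(\mathcal C)$, $M\mapsto (M_{ij})_{i,j}$, such that, regarding $M_{ij}$ as an $L$-bimodule via the projections $L\to L_i$ and $L\to L_j$, one has $M\cong\bigoplus_{i,j}M_{ij}$ naturally in $M$. It is compatible with the multitensor structure: for an $(L_i,L_j)$-bimodule $M$ and an $(L_k,L_l)$-bimodule $N$ one has $M\otimes_L N=0$ if $j\ne k$, while for $j=k$ the canonical morphism $M\otimes N\to M\otimes_{L_j}N$ induces an isomorphism of $L$-bimodules $M\otimes_L N\cong M\otimes_{L_j}N$; and the unit $L$ has components $L_{ii}\cong L_i$ as $L_i$-bimodules and $L_{ij}=0$ for $i\neq j$. -/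

import Mathlib

open CategoryTheory CategoryTheory.Limits CategoryTheory.MonoidalCategory
open scoped CategoryTheory.MonObj CategoryTheory.MonoidalCategory.MonoidalLeftAction

namespace FinTens

universe w v u v₁ u₁ v₂ u₂

/-! ### Finite linear categories and finite tensor categories -/

/-- A `𝕜`-linear category is finite if it is equivalent, as a `𝕜`-linear category, to the category
of finite-dimensional modules over a finite-dimensional `𝕜`-algebra. (A module over such an algebra
is finite-dimensional iff it is finitely generated.) -/
def IsFiniteLinear (𝕜 : Type w) [Field 𝕜] (M : Type u₁) [Category.{v₁} M] [Preadditive M]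
    [Linear 𝕜 M] : Prop :=
  ∃ (A : Type w) (_ : Ring A) (_ : Algebra 𝕜 A) (_ : Module.Finite 𝕜 A)
    (e : M ≌ FGModuleCat.{w} A), e.functor.Additive ∧ e.functor.Linear 𝕜

/-- A finite tensor category over `𝕜`: a finite `𝕜`-linear abelian rigid monoidal category with
bilinear tensor product and simple unit. -/
class IsFiniteTensorCategory (𝕜 : Type w) [Field 𝕜] (C : Type u) [Category.{v} C] [Abelian C]
    [Linear 𝕜 C] [MonoidalCategory C] [RigidCategory C] [MonoidalPreadditive C] : Prop
    extends MonoidalLinear 𝕜 C where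
  simple_unit : Simple (𝟙_ C)
  finite : IsFiniteLinear 𝕜 C

/-! ### Direct sums of categories

The direct sum of a finite family of additive categories is the product category. -/

section DirectSum

variable {I : Type*} (M : I → Type u₁) [∀ i, Category.{v₁} (M i)]

instance piPreadditive [∀ i, Preadditive (M i)] : Preadditive (∀ i, M i) where
  homGroup X Y := inferInstanceAs (AddCommGroup (∀ i, X i ⟶ Y i))
  add_comp _ _ _ f f' g := funext fun i => Preadditive.add_comp _ _ _ (f i) (f' i) (g i)
  comp_add _ _ _ f g g' := funext fun i => Preadditive.comp_add _ _ _ (f i) (g i) (g' i)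

instance piLinear (𝕜 : Type w) [Field 𝕜] [∀ i, Preadditive (M i)] [∀ i, Linear 𝕜 (M i)] :
    Linear 𝕜 (∀ i, M i) where
  homModule X Y := inferInstanceAs (Module 𝕜 (∀ i, X i ⟶ Y i))
  smul_comp _ _ _ r f g := funext fun i => Linear.smul_comp _ _ _ r (f i) (g i)
  comp_smul _ _ _ f r g := funext fun i => Linear.comp_smul _ _ _ (f i) r (g i)

/-- The componentwise action of `C` on a direct sum of module categories. -/
instance piAction (C : Type u) [Category.{v} C] [MonoidalCategory C]
    [∀ i, MonoidalLeftAction C (M i)] : MonoidalLeftAction C (∀ i, M i) where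
  actionObj c X := fun i => c ⊙ₗ X i
  actionHomLeft f X := fun i => f ⊵ₗ X i
  actionHomRight c _ _ g := fun i => c ⊴ₗ g i
  actionHom f g := fun i => f ⊙ₗₘ g i
  actionAssocIso c c' X := Pi.isoMk fun i => αₗ c c' (X i)
  actionUnitIso X := Pi.isoMk fun i => λₗ (X i)
  actionHom_def f g := funext fun i => MonoidalLeftAction.actionHom_def f (g i)
  actionHomRight_id c X := funext fun i => MonoidalLeftAction.actionHomRight_id c (X i)
  id_actionHomLeft c X := funext fun i => MonoidalLeftAction.id_actionHomLeft c (X i)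
  actionHom_comp f₁ f₂ g₁ g₂ :=
    funext fun i => MonoidalLeftAction.actionHom_comp f₁ f₂ (g₁ i) (g₂ i)
  actionAssocIso_hom_naturality f g h :=
    funext fun i => MonoidalLeftAction.actionAssocIso_hom_naturality f g (h i)
  actionUnitIso_hom_naturality f :=
    funext fun i => MonoidalLeftAction.actionUnitIso_hom_naturality (f i)
  whiskerLeft_actionHomLeft c _ _ f X :=
    funext fun i => MonoidalLeftAction.whiskerLeft_actionHomLeft c f (X i)
  whiskerRight_actionHomLeft c f X :=
    funext fun i => MonoidalLeftAction.whiskerRight_actionHomLeft c f (X i)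
  associator_actionHom c₁ c₂ c₃ X :=
    funext fun i => MonoidalLeftAction.associator_actionHom c₁ c₂ c₃ (X i)
  leftUnitor_actionHom c X := funext fun i => MonoidalLeftAction.leftUnitor_actionHom c (X i)
  rightUnitor_actionHom c X := funext fun i => MonoidalLeftAction.rightUnitor_actionHom c (X i)

end DirectSum

/-! ### Module categories -/

section ModuleCategories

variable (𝕜 : Type w) [Field 𝕜] (C : Type u) [Category.{v} C] [Preadditive C] [Linear 𝕜 C]
  [MonoidalCategory C]

/-- The linear structure required of a module category over a finite tensor category: the underlying
category is finite, and the action is bilinear on morphisms and exact in the first variable. -/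
structure IsModuleCategory (M : Type u₁) [Category.{v₁} M] [Preadditive M] [Linear 𝕜 M]
    [MonoidalLeftAction C M] : Prop where
  finite : IsFiniteLinear 𝕜 M
  add_actionHomLeft : ∀ {c c' : C} (f g : c ⟶ c') (m : M), (f + g) ⊵ₗ m = f ⊵ₗ m + g ⊵ₗ m
  smul_actionHomLeft : ∀ {c c' : C} (r : 𝕜) (f : c ⟶ c') (m : M), (r • f) ⊵ₗ m = r • (f ⊵ₗ m)
  actionHomRight_add : ∀ (c : C) {m m' : M} (f g : m ⟶ m'), c ⊴ₗ (f + g) = c ⊴ₗ f + c ⊴ₗ g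
  actionHomRight_smul : ∀ (c : C) {m m' : M} (r : 𝕜) (f : m ⟶ m'), c ⊴ₗ (r • f) = r • (c ⊴ₗ f)
  preservesFiniteLimits : ∀ m : M, PreservesFiniteLimits (MonoidalLeftAction.actionRight C m)
  preservesFiniteColimits : ∀ m : M, PreservesFiniteColimits (MonoidalLeftAction.actionRight C m)

/-- An equivalence of `C`-module categories: a `𝕜`-linear equivalence of categories together with
coherent natural isomorphisms `c ⊙ₗ F m ≅ F (c ⊙ₗ m)`. -/
structure ModuleEquivalence (M : Type u₁) [Category.{v₁} M] [Preadditive M] [Linear 𝕜 M]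
    [MonoidalLeftAction C M] (N : Type u₂) [Category.{v₂} N] [Preadditive N] [Linear 𝕜 N]
    [MonoidalLeftAction C N] where
  equiv : M ≌ N
  additive : equiv.functor.Additive
  linear : equiv.functor.Linear 𝕜
  leftLinear : equiv.functor.LeftLinear C

/-- A module category is exact if `P ⊙ₗ m` is projective for all projective `P` in `C` and all `m`
in `M`. -/
def IsExactModuleCategory (M : Type u₁) [Category.{v₁} M] [MonoidalLeftAction C M] : Prop :=
  ∀ (P : C) (m : M), Projective P → Projective (P ⊙ₗ m)

/-- A module category is indecomposable if it is not equivalent, as a module category, to a direct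
sum of two nonzero module categories. -/
def IsIndecomposableModuleCategory (M : Type u₁) [Category.{v₁} M] [Preadditive M] [Linear 𝕜 M]
    [MonoidalLeftAction C M] : Prop :=
  ¬ ∃ (N : Fin 2 → Type u₁) (_ : ∀ i, Category.{v₁} (N i)) (_ : ∀ i, Abelian (N i))
      (_ : ∀ i, Linear 𝕜 (N i)) (_ : ∀ i, MonoidalLeftAction C (N i)),
      (∀ i, IsModuleCategory 𝕜 C (N i)) ∧ (∀ i, ∃ n : N i, ¬ IsZero n) ∧
        Nonempty (ModuleEquivalence 𝕜 C M (∀ i, N i))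

end ModuleCategories

/-! ### Right modules over an algebra -/

section RightModules

variable {C : Type u} [Category.{v} C] [MonoidalCategory C]

/-- A right module over an algebra (monoid object) `A` in `C`. -/
structure RightMod (A : Mon C) where
  X : C
  act : X ⊗ A.X ⟶ X
  act_one : X ◁ η[A.X] ≫ act = (ρ_ X).hom
  assoc : X ◁ μ[A.X] ≫ act = (α_ X A.X A.X).inv ≫ act ▷ A.X ≫ act

namespace RightMod

/-- A morphism of right modules. -/
@[ext]
structure Hom {A : Mon C} (M N : RightMod A) where
  hom : M.X ⟶ N.X
  act_hom : M.act ≫ hom = hom ▷ A.X ≫ N.act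

variable {A : Mon C}

instance : Category (RightMod A) where
  Hom M N := Hom M N
  id M := ⟨𝟙 M.X, by simp⟩
  comp f g := ⟨f.hom ≫ g.hom, by
    rw [← Category.assoc, f.act_hom, Category.assoc, g.act_hom, comp_whiskerRight, Category.assoc]⟩

@[ext]
lemma hom_ext {M N : RightMod A} (f g : M ⟶ N) (h : f.hom = g.hom) : f = g := Hom.ext h

@[simp] lemma id_hom (M : RightMod A) : Hom.hom (𝟙 M) = 𝟙 M.X := rfl

@[simp] lemma comp_hom {M N K : RightMod A} (f : M ⟶ N) (g : N ⟶ K) :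
    (f ≫ g).hom = f.hom ≫ g.hom := rfl

/-- Isomorphisms of right modules from isomorphisms in `C` compatible with the actions. -/
@[simps]
def isoMk {M N : RightMod A} (e : M.X ≅ N.X) (h : M.act ≫ e.hom = e.hom ▷ A.X ≫ N.act) :
    M ≅ N where
  hom := ⟨e.hom, h⟩
  inv := ⟨e.inv, by rw [← cancel_mono e.hom, Category.assoc, Category.assoc, h]; simp⟩

section Linear

variable [Preadditive C] [MonoidalPreadditive C]

instance (M N : RightMod A) : Add (M ⟶ N) where
  add f g := ⟨f.hom + g.hom, by simp [f.act_hom, g.act_hom]⟩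

instance (M N : RightMod A) : Zero (M ⟶ N) where
  zero := ⟨0, by simp⟩

instance (M N : RightMod A) : Neg (M ⟶ N) where
  neg f := ⟨-f.hom, by
    have h : (-f.hom) ▷ A.X = -(f.hom ▷ A.X) := (tensorRight A.X).map_neg
    rw [h, Preadditive.comp_neg, Preadditive.neg_comp, f.act_hom]⟩

@[simp] lemma add_hom {M N : RightMod A} (f g : M ⟶ N) : (f + g).hom = f.hom + g.hom := rfl
@[simp] lemma zero_hom {M N : RightMod A} : (0 : M ⟶ N).hom = 0 := rfl
@[simp] lemma neg_hom {M N : RightMod A} (f : M ⟶ N) : (-f).hom = -f.hom := rfl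

instance : Preadditive (RightMod A) where
  homGroup M N :=
    { add_assoc := fun f g h => by ext; simp [add_assoc]
      zero_add := fun f => by ext; simp
      add_zero := fun f => by ext; simp
      add_comm := fun f g => by ext; simp [add_comm]
      neg_add_cancel := fun f => by ext; simp
      nsmul := nsmulRec
      zsmul := zsmulRec }
  add_comp _ _ _ _ _ _ := by ext; simp
  comp_add _ _ _ _ _ _ := by ext; simp

variable (𝕜 : Type w) [Field 𝕜] [Linear 𝕜 C] [MonoidalLinear 𝕜 C]

instance (M N : RightMod A) : SMul 𝕜 (M ⟶ N) where
  smul r f := ⟨r • f.hom, by simp [f.act_hom]⟩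

variable {𝕜} in
@[simp] lemma smul_hom {M N : RightMod A} (r : 𝕜) (f : M ⟶ N) : (r • f).hom = r • f.hom := rfl

instance : Linear 𝕜 (RightMod A) where
  homModule M N :=
    { one_smul := fun f => by ext; simp
      mul_smul := fun r s f => by ext; simp [mul_smul]
      smul_zero := fun r => by ext; simp
      smul_add := fun r f g => by ext; simp
      add_smul := fun r s f => by ext; simp [add_smul]
      zero_smul := fun f => by ext; simp }
  smul_comp _ _ _ _ _ _ := by ext; simp
  comp_smul _ _ _ _ _ _ := by ext; simp

end Linear

/-- The right module `c ⊗ M`, for `c` in `C` and `M` a right module. -/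
@[simps]
def tensorObj (c : C) (M : RightMod A) : RightMod A where
  X := c ⊗ M.X
  act := (α_ c M.X A.X).hom ≫ c ◁ M.act
  act_one := by
    have h := congrArg (fun t => c ◁ t) M.act_one
    simp only [whiskerLeft_comp] at h
    simp [h]
  assoc := by
    have h := congrArg (fun t => c ◁ t) M.assoc
    simp only [whiskerLeft_comp] at h
    simp [h]

/-- The left `C`-module category structure on the category of right `A`-modules. -/
instance : MonoidalLeftAction C (RightMod A) where
  actionObj c M := tensorObj c M
  actionHomLeft {c c'} f M := ⟨f ▷ M.X, by
    change ((α_ c M.X A.X).hom ≫ c ◁ M.act) ≫ f ▷ M.X =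
      f ▷ M.X ▷ A.X ≫ (α_ c' M.X A.X).hom ≫ c' ◁ M.act
    simp [whisker_exchange]⟩
  actionHomRight c {M N} g := ⟨c ◁ g.hom, by
    change ((α_ c M.X A.X).hom ≫ c ◁ M.act) ≫ c ◁ g.hom =
      (c ◁ g.hom) ▷ A.X ≫ (α_ c N.X A.X).hom ≫ c ◁ N.act
    rw [Category.assoc, ← whiskerLeft_comp, g.act_hom]
    simp⟩
  actionAssocIso c c' M := isoMk (α_ c c' M.X) (by
    change ((α_ (c ⊗ c') M.X A.X).hom ≫ (c ⊗ c') ◁ M.act) ≫ (α_ c c' M.X).hom =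
      (α_ c c' M.X).hom ▷ A.X ≫ (α_ c (c' ⊗ M.X) A.X).hom ≫
        c ◁ ((α_ c' M.X A.X).hom ≫ c' ◁ M.act)
    simp)
  actionUnitIso M := isoMk (λ_ M.X) (by
    change ((α_ (𝟙_ C) M.X A.X).hom ≫ 𝟙_ C ◁ M.act) ≫ (λ_ M.X).hom =
      (λ_ M.X).hom ▷ A.X ≫ M.act
    simp)
  actionHom_def _ _ := rfl
  actionHomRight_id c M := hom_ext _ _ (MonoidalLeftAction.actionHomRight_id c M.X)
  id_actionHomLeft c M := hom_ext _ _ (MonoidalLeftAction.id_actionHomLeft c M.X)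
  actionHom_comp {c c' c'' M M' M''} f₁ f₂ g₁ g₂ := hom_ext _ _ (by
    change (f₁ ≫ f₂) ▷ M.X ≫ c'' ◁ (g₁.hom ≫ g₂.hom) =
      (f₁ ▷ M.X ≫ c' ◁ g₁.hom) ≫ f₂ ▷ M'.X ≫ c'' ◁ g₂.hom
    simp [whisker_exchange_assoc])
  actionAssocIso_hom_naturality {c₁ c₂ c₃ c₄ M N} f g h := hom_ext _ _ (by
    change ((f ⊗ₘ g) ▷ M.X ≫ (c₂ ⊗ c₄) ◁ h.hom) ≫ (α_ c₂ c₄ N.X).hom =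
      (α_ c₁ c₃ M.X).hom ≫ f ▷ (c₃ ⊗ M.X) ≫ c₂ ◁ (g ▷ M.X ≫ c₄ ◁ h.hom)
    simp [MonoidalCategory.tensorHom_def])
  actionUnitIso_hom_naturality f :=
    hom_ext _ _ (MonoidalLeftAction.actionUnitIso_hom_naturality (C := C) f.hom)
  whiskerLeft_actionHomLeft c _ _ f M :=
    hom_ext _ _ (MonoidalLeftAction.whiskerLeft_actionHomLeft c f M.X)
  whiskerRight_actionHomLeft c f M :=
    hom_ext _ _ (MonoidalLeftAction.whiskerRight_actionHomLeft c f M.X)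
  associator_actionHom c₁ c₂ c₃ M :=
    hom_ext _ _ (MonoidalLeftAction.associator_actionHom c₁ c₂ c₃ M.X)
  leftUnitor_actionHom c M := hom_ext _ _ (MonoidalLeftAction.leftUnitor_actionHom c M.X)
  rightUnitor_actionHom c M := hom_ext _ _ (MonoidalLeftAction.rightUnitor_actionHom c M.X)

end RightMod

/-- An algebra is exact if its category of right modules is an exact module category. -/
def IsExactAlgebra (A : Mon C) : Prop :=
  IsExactModuleCategory C (RightMod A)

/-- An algebra is indecomposable if its category of right modules is an indecomposable module
category. -/
def IsIndecomposableAlgebra (𝕜 : Type w) [Field 𝕜] [Preadditive C] [MonoidalPreadditive C]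
    [Linear 𝕜 C] [MonoidalLinear 𝕜 C] (A : Mon C) : Prop :=
  IsIndecomposableModuleCategory 𝕜 C (RightMod A)

end RightModules

/-! ### Bimodules -/

section Bimodules

variable {C : Type u} [Category.{v} C] [MonoidalCategory C]

@[simp] lemma bimod_comp_hom {A B : Mon C} {M N K : Bimod A B} (f : M ⟶ N) (g : N ⟶ K) :
    (f ≫ g).hom = f.hom ≫ g.hom := rfl

section Linear

variable [Preadditive C] [MonoidalPreadditive C] {A B : Mon C}

instance (M N : Bimod A B) : Add (M ⟶ N) where
  add f g := ⟨f.hom + g.hom, by simp, by simp⟩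

instance (M N : Bimod A B) : Zero (M ⟶ N) where
  zero := ⟨0, by simp, by simp⟩

instance (M N : Bimod A B) : Neg (M ⟶ N) where
  neg f := ⟨-f.hom,
    by
      have h : A.X ◁ (-f.hom) = -(A.X ◁ f.hom) := (tensorLeft A.X).map_neg
      rw [h, Preadditive.comp_neg, Preadditive.neg_comp, f.left_act_hom],
    by
      have h : (-f.hom) ▷ B.X = -(f.hom ▷ B.X) := (tensorRight B.X).map_neg
      rw [h, Preadditive.comp_neg, Preadditive.neg_comp, f.right_act_hom]⟩

@[simp] lemma bimod_add_hom {M N : Bimod A B} (f g : M ⟶ N) :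
    (f + g).hom = f.hom + g.hom := rfl
@[simp] lemma bimod_zero_hom {M N : Bimod A B} : (0 : M ⟶ N).hom = 0 := rfl
@[simp] lemma bimod_neg_hom {M N : Bimod A B} (f : M ⟶ N) : (-f).hom = -f.hom := rfl

instance : Preadditive (Bimod A B) where
  homGroup M N :=
    { add_assoc := fun f g h => by ext; simp [add_assoc]
      zero_add := fun f => by ext; simp
      add_zero := fun f => by ext; simp
      add_comm := fun f g => by ext; simp [add_comm]
      neg_add_cancel := fun f => by ext; simp
      nsmul := nsmulRec
      zsmul := zsmulRec }
  add_comp _ _ _ _ _ _ := by ext; simp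
  comp_add _ _ _ _ _ _ := by ext; simp

variable (𝕜 : Type w) [Field 𝕜] [Linear 𝕜 C] [MonoidalLinear 𝕜 C]

instance (M N : Bimod A B) : SMul 𝕜 (M ⟶ N) where
  smul r f := ⟨r • f.hom, by simp, by simp⟩

variable {𝕜} in
@[simp] lemma bimod_smul_hom {M N : Bimod A B} (r : 𝕜) (f : M ⟶ N) :
    (r • f).hom = r • f.hom := rfl

instance : Linear 𝕜 (Bimod A B) where
  homModule M N :=
    { one_smul := fun f => by ext; simp
      mul_smul := fun r s f => by ext; simp [mul_smul]
      smul_zero := fun r => by ext; simp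
      smul_add := fun r f g => by ext; simp
      add_smul := fun r s f => by ext; simp [add_smul]
      zero_smul := fun f => by ext; simp }
  smul_comp _ _ _ _ _ _ := by ext; simp
  comp_smul _ _ _ _ _ _ := by ext; simp

end Linear

/-- Restriction of scalars of a bimodule along algebra morphisms on both sides. -/
@[simps]
def restrictObj {A A' B B' : Mon C} (f : A ⟶ A') (g : B ⟶ B') (M : Bimod A' B') : Bimod A B where
  X := M.X
  actLeft := f.hom ▷ M.X ≫ M.actLeft
  one_actLeft := by
    rw [← comp_whiskerRight_assoc, IsMonHom.one_hom, M.one_actLeft]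
  left_assoc := by
    have h : f.hom ▷ (A'.X ⊗ M.X) ≫ A'.X ◁ M.actLeft = A.X ◁ M.actLeft ≫ f.hom ▷ M.X :=
      (whisker_exchange _ _).symm
    rw [← comp_whiskerRight_assoc, IsMonHom.mul_hom, comp_whiskerRight_assoc, M.left_assoc,
      whiskerLeft_comp, Category.assoc, ← reassoc_of% h, MonoidalCategory.tensorHom_def']
    simp
  actRight := M.X ◁ g.hom ≫ M.actRight
  actRight_one := by
    rw [← whiskerLeft_comp_assoc, IsMonHom.one_hom, M.actRight_one]
  right_assoc := by
    have h : (M.X ⊗ B'.X) ◁ g.hom ≫ M.actRight ▷ B'.X = M.actRight ▷ B.X ≫ M.X ◁ g.hom :=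
      whisker_exchange _ _
    rw [← whiskerLeft_comp_assoc, IsMonHom.mul_hom, whiskerLeft_comp_assoc, M.right_assoc,
      comp_whiskerRight, Category.assoc, ← reassoc_of% h, MonoidalCategory.tensorHom_def]
    simp
  middle_assoc := by
    have h : (A'.X ⊗ M.X) ◁ g.hom ≫ M.actLeft ▷ B'.X = M.actLeft ▷ B.X ≫ M.X ◁ g.hom :=
      whisker_exchange _ _
    have h' : f.hom ▷ (M.X ⊗ B'.X) ≫ A'.X ◁ M.actRight = A.X ◁ M.actRight ≫ f.hom ▷ M.X :=
      (whisker_exchange _ _).symm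
    rw [comp_whiskerRight, Category.assoc, ← reassoc_of% h, M.middle_assoc, whiskerLeft_comp,
      Category.assoc, ← reassoc_of% h', whisker_exchange_assoc]
    simp

/-- Restriction of scalars of bimodules as a functor. -/
@[simps]
def restrict {A A' B B' : Mon C} (f : A ⟶ A') (g : B ⟶ B') : Bimod A' B' ⥤ Bimod A B where
  obj M := restrictObj f g M
  map {M N} h :=
    ⟨h.hom,
      show (f.hom ▷ M.X ≫ M.actLeft) ≫ h.hom = A.X ◁ h.hom ≫ f.hom ▷ N.X ≫ N.actLeft by
        rw [Category.assoc, h.left_act_hom, ← whisker_exchange_assoc],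
      show (M.X ◁ g.hom ≫ M.actRight) ≫ h.hom = h.hom ▷ B.X ≫ N.X ◁ g.hom ≫ N.actRight by
        rw [Category.assoc, h.right_act_hom, whisker_exchange_assoc]⟩

section Rigid

/-- In a rigid category, tensoring with an object has a right adjoint, hence preserves colimits. -/
instance preservesColimits_tensorLeft [RigidCategory C] (X : C) :
    PreservesColimitsOfSize.{0, 0} (tensorLeft X) :=
  (tensorLeftAdjunction (ᘁX) X).leftAdjoint_preservesColimits

instance preservesColimits_tensorRight [RigidCategory C] (X : C) :
    PreservesColimitsOfSize.{0, 0} (tensorRight X) :=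
  (tensorRightAdjunction X Xᘁ).leftAdjoint_preservesColimits

end Rigid

/-- Let `p i : L ⟶ L' i` be algebra morphisms. An equivalence `Φ` from `L`-bimodules to the direct
sum over `(i, j)` of `(L' i, L' j)`-bimodules is a decomposition of the multitensor category of
`L`-bimodules if it is linear and identifies each bimodule `M`, naturally in `M`, with the direct sum
of its components `(Φ M)_{ij}` (viewed as `L`-bimodules along `p i` and `p j`), in such a way that
* the canonical epimorphism `M ⊗ N ⟶ M ⊗_L N` induces an isomorphism
  `M ⊗_L N ≅ M ⊗_{L' j} N` for components `M` of type `(i, j)` and `N` of type `(j, k)`;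
* `M ⊗_L N = 0` for components `M` of type `(i, j)` and `N` of type `(k, l)` with `j ≠ k`;
* the unit bimodule `L` has components `L' i` on the diagonal and `0` off the diagonal.

Thus `⊗_L` corresponds to `(M ⊗ N)_{ik} = ⨁ j, M_{ij} ⊗_{L' j} N_{jk}`. -/
structure IsBimodDecomposition (𝕜 : Type w) [Field 𝕜] [Abelian C] [Linear 𝕜 C] [RigidCategory C]
    [MonoidalPreadditive C] [MonoidalLinear 𝕜 C] {L : Mon C} {n : ℕ} {L' : Fin n → Mon C}
    (p : ∀ i, L ⟶ L' i)
    (Φ : Bimod L L ≌ (∀ ij : Fin n × Fin n, Bimod (L' ij.1) (L' ij.2))) : Prop where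
  additive : Φ.functor.Additive
  linear : Φ.functor.Linear 𝕜
  directSum : ∃ incl : ∀ ij : Fin n × Fin n,
    Φ.functor ⋙ Pi.eval (fun ij : Fin n × Fin n => Bimod (L' ij.1) (L' ij.2)) ij ⋙
      restrict (p ij.1) (p ij.2) ⟶ 𝟭 (Bimod L L),
    ∀ M : Bimod L L, Nonempty (IsColimit (Cofan.mk M fun ij => (incl ij).app M))
  tensor : ∀ (i j k : Fin n) (M : Bimod (L' i) (L' j)) (N : Bimod (L' j) (L' k)),
    ∃ φ : (restrictObj (p i) (p j) M).tensorBimod (restrictObj (p j) (p k) N) ≅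
        restrictObj (p i) (p k) (M.tensorBimod N),
      coequalizer.π ((restrictObj (p i) (p j) M).actRight ▷ N.X)
          ((α_ M.X L.X N.X).hom ≫ M.X ◁ (restrictObj (p j) (p k) N).actLeft) ≫ φ.hom.hom =
        coequalizer.π (M.actRight ▷ N.X) ((α_ M.X (L' j).X N.X).hom ≫ M.X ◁ N.actLeft)
  tensor_zero : ∀ (i j k l : Fin n) (M : Bimod (L' i) (L' j)) (N : Bimod (L' k) (L' l)), j ≠ k →
    IsZero ((restrictObj (p i) (p j) M).tensorBimod (restrictObj (p k) (p l) N))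
  unit_diag : ∀ i : Fin n, Nonempty (Φ.functor.obj (Bimod.regular L) (i, i) ≅ Bimod.regular (L' i))
  unit_offDiag : ∀ i j : Fin n, i ≠ j → IsZero (Φ.functor.obj (Bimod.regular L) (i, j))

end Bimodules

end FinTens

namespace FinTens

universe w v u v₁ u₁ v₂ u₂

/-! ### Block decompositions of additive categories -/

section Blocks

variable {D : Type u} [Category.{v} D] [Preadditive D] {S : Type*} [Fintype S]
  {B : S → Type u₁} [∀ s, Category.{v₁} (B s)]

/-- A decomposition of a preadditive category `D` into blocks, embedded by functors `R s`: a
complete family of orthogonal idempotent endomorphisms `E s` of the identity functor of `D`, all of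
whose images lie in the corresponding block. -/
structure BlockDecomposition (R : ∀ s, B s ⥤ D) where
  E : ∀ (_ : S) (M : D), M ⟶ M
  natural : ∀ (s : S) {M N : D} (f : M ⟶ N), E s M ≫ f = f ≫ E s N
  sum_E : ∀ M : D, ∑ s, E s M = 𝟙 M
  orthogonal : ∀ {s t : S}, s ≠ t → ∀ M : D, E s M ≫ E t M = 0
  E_obj : ∀ (s : S) (X : B s), E s ((R s).obj X) = 𝟙 _
  obj : ∀ s, D → B s
  inj : ∀ (s : S) (M : D), (R s).obj (obj s M) ⟶ M
  proj : ∀ (s : S) (M : D), M ⟶ (R s).obj (obj s M)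
  inj_proj : ∀ (s : S) (M : D), inj s M ≫ proj s M = 𝟙 _
  proj_inj : ∀ (s : S) (M : D), proj s M ≫ inj s M = E s M
  exists_sum : ∀ X : ∀ s, B s, ∃ (M : D) (i : ∀ s, (R s).obj (X s) ⟶ M)
    (q : ∀ s, M ⟶ (R s).obj (X s)), (∀ s, i s ≫ q s = 𝟙 _) ∧ ∑ s, q s ≫ i s = 𝟙 M

namespace BlockDecomposition

variable {R : ∀ s, B s ⥤ D} (T : BlockDecomposition R)

lemma E_E (s : S) (M : D) : T.E s M ≫ T.E s M = T.E s M := by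
  rw [← T.proj_inj, Category.assoc, reassoc_of% T.inj_proj]

lemma inj_E (s : S) (M : D) : T.inj s M ≫ T.E s M = T.inj s M := by
  rw [← T.proj_inj, reassoc_of% T.inj_proj]

lemma E_proj (s : S) (M : D) : T.E s M ≫ T.proj s M = T.proj s M := by
  rw [← T.proj_inj, Category.assoc, T.inj_proj, Category.comp_id]

lemma hom_eq_zero (T : BlockDecomposition R) {s t : S} (h : s ≠ t) {X : B s} {Y : B t}
    (f : (R s).obj X ⟶ (R t).obj Y) : f = 0 := by
  rw [← Category.id_comp f, ← Category.comp_id f, ← T.E_obj s X, ← T.E_obj t Y,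
    ← T.natural t f, reassoc_of% T.orthogonal h, zero_comp]

lemma hom_eq_sum {M N : D} (f : M ⟶ N) :
    f = ∑ s, T.proj s M ≫ (T.inj s M ≫ f ≫ T.proj s N) ≫ T.inj s N := by
  have h : ∀ s, T.proj s M ≫ (T.inj s M ≫ f ≫ T.proj s N) ≫ T.inj s N = T.E s M ≫ f := fun s => by
    simp only [Category.assoc, T.proj_inj, reassoc_of% T.proj_inj]
    rw [← T.natural, reassoc_of% T.E_E]
  simp only [h, ← Preadditive.sum_comp, T.sum_E, Category.id_comp]

lemma id_map_obj_eq_zero {s : S} {M : D} (h : T.E s M = 0) : 𝟙 ((R s).obj (T.obj s M)) = 0 := by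
  rw [← T.inj_proj, ← T.inj_E, h, comp_zero, zero_comp]

variable [∀ s, (R s).Full] [∀ s, (R s).Faithful]

/-- The functor sending an object to the family of its components in the blocks. -/
@[simps]
noncomputable def functor : D ⥤ ∀ s, B s where
  obj M s := T.obj s M
  map {M N} f s := (R s).preimage (T.inj s M ≫ f ≫ T.proj s N)
  map_id M := funext fun s => (R s).map_injective (by simp [T.inj_proj])
  map_comp {M N K} f g := funext fun s => (R s).map_injective (by
    simp only [Functor.map_preimage, Pi.comp_apply, Functor.map_comp, Category.assoc,
      reassoc_of% T.proj_inj]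
    rw [reassoc_of% T.natural, T.E_proj])

instance : T.functor.Faithful where
  map_injective {M N f g} h := by
    rw [T.hom_eq_sum f, T.hom_eq_sum g]
    refine Finset.sum_congr rfl fun s _ => ?_
    rw [← (R s).map_preimage (T.inj s M ≫ f ≫ T.proj s N),
      ← (R s).map_preimage (T.inj s M ≫ g ≫ T.proj s N)]
    exact congrArg (fun k => T.proj s M ≫ (R s).map k ≫ T.inj s N) (congrFun h s)

instance : T.functor.Full where
  map_surjective {M N} g := by
    classical
    let k : ∀ s, T.obj s M ⟶ T.obj s N := g
    refine ⟨∑ s, T.proj s M ≫ (R s).map (k s) ≫ T.inj s N, funext fun s => (R s).map_injective ?_⟩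
    refine ((R s).map_preimage _).trans (?_ : _ = (R s).map (k s))
    simp only [Preadditive.sum_comp, Preadditive.comp_sum]
    rw [Finset.sum_eq_single s]
    · rw [Category.assoc, Category.assoc, reassoc_of% T.inj_proj, T.inj_proj, Category.comp_id]
    · intro t _ ht
      rw [Category.assoc, ← Category.assoc (T.inj s M),
        T.hom_eq_zero ht.symm (T.inj s M ≫ T.proj t M), zero_comp]
    · simp

/-- The components of an object are determined up to isomorphism by the idempotents. -/
noncomputable def objIso {s : S} {M : D} {Y : B s} (i : (R s).obj Y ⟶ M) (q : M ⟶ (R s).obj Y)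
    (h : i ≫ q = 𝟙 _) (h' : q ≫ i = T.E s M) : T.obj s M ≅ Y :=
  (R s).preimageIso
    { hom := T.inj s M ≫ q
      inv := i ≫ T.proj s M
      hom_inv_id := by rw [Category.assoc, reassoc_of% h', T.E_proj, T.inj_proj]
      inv_hom_id := by
        rw [Category.assoc, reassoc_of% T.proj_inj, ← h', Category.assoc, h, Category.comp_id, h] }

instance : T.functor.EssSurj where
  mem_essImage X := by
    classical
    obtain ⟨M, i, q, h, hs⟩ := T.exists_sum X
    refine ⟨M, ⟨Pi.isoMk fun s => T.objIso (i s) (q s) (h s) ?_⟩⟩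
    rw [← Category.comp_id (T.E s M), ← hs, Preadditive.comp_sum, Finset.sum_eq_single s]
    · rw [reassoc_of% T.natural, T.E_obj, Category.id_comp]
    · intro t _ ht
      rw [reassoc_of% T.natural, ← Category.id_comp (T.E s _), ← T.E_obj t, T.orthogonal ht,
        zero_comp, comp_zero]
    · simp

instance : T.functor.IsEquivalence where

/-- The equivalence of a category with the direct sum of its blocks. -/
noncomputable def equivalence : D ≌ ∀ s, B s := T.functor.asEquivalence

/-- The inclusions of the components of an object, as a natural transformation. -/
noncomputable def incl (s : S) : T.functor ⋙ Pi.eval B s ⋙ R s ⟶ 𝟭 D where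
  app M := T.inj s M
  naturality M N f := by
    change (R s).map ((R s).preimage (T.inj s M ≫ f ≫ T.proj s N)) ≫ T.inj s N = T.inj s M ≫ f
    rw [(R s).map_preimage, Category.assoc, Category.assoc, T.proj_inj, ← T.natural,
      reassoc_of% T.inj_E]

/-- An object is the direct sum of its components. -/
noncomputable def isColimitCofan (M : D) : IsColimit (Cofan.mk M fun s => (T.incl s).app M) :=
  Cofan.IsColimit.mk _ (fun c => ∑ s, T.proj s M ≫ c.inj s)
    (fun c s => by
      classical
      let k : ∀ s, (R s).obj (T.obj s M) ⟶ c.pt := c.inj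
      change T.inj s M ≫ ∑ s, T.proj s M ≫ k s = k s
      rw [Preadditive.comp_sum, Finset.sum_eq_single s]
      · rw [reassoc_of% T.inj_proj]
      · intro t _ ht
        rw [← Category.assoc, T.hom_eq_zero ht.symm (T.inj s M ≫ T.proj t M), zero_comp]
      · simp)
    (fun c m hm => by
      let k : M ⟶ c.pt := m
      refine (?_ : k = _)
      rw [← Category.id_comp k, ← T.sum_E, Preadditive.sum_comp]
      refine Finset.sum_congr rfl fun s _ => ?_
      rw [← T.proj_inj, Category.assoc]
      exact congrArg (fun t => T.proj s M ≫ t) (hm s))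

/-- Epimorphisms in a block remain epimorphisms in the whole category. -/
lemma epi_map (T : BlockDecomposition R) [∀ s, Preadditive (B s)] [∀ s, (R s).Additive]
    {s : S} {X Y : B s} (f : X ⟶ Y)
    [Epi f] : Epi ((R s).map f) := by
  refine Preadditive.epi_of_cancel_zero _ fun {K} g hg => ?_
  have h : f ≫ (R s).preimage (g ≫ T.proj s K) = 0 := (R s).map_injective (by
    rw [Functor.map_comp, Functor.map_preimage, reassoc_of% hg, zero_comp, Functor.map_zero])
  have h' : g ≫ T.proj s K = 0 := by
    have := congrArg (R s).map ((cancel_epi f).1 (h.trans comp_zero.symm))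
    rwa [Functor.map_preimage, Functor.map_zero] at this
  rw [← Category.id_comp g, ← T.E_obj, T.natural, ← T.proj_inj, reassoc_of% h', zero_comp]

/-- An object of a block is projective if it is projective in the whole category. -/
lemma projective_of_map (T : BlockDecomposition R) [∀ s, Preadditive (B s)] [∀ s, (R s).Additive]
    {s : S} {X : B s}
    (h : Projective ((R s).obj X)) : Projective X :=
  have : (R s).PreservesEpimorphisms := ⟨fun f _ => T.epi_map f⟩
  (R s).projective_of_map_projective h

lemma functor_additive [∀ s, Preadditive (B s)] [∀ s, (R s).Additive] :
    T.functor.Additive where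
  map_add {M N f g} := funext fun s => (R s).map_injective (by
    change (R s).map ((R s).preimage (T.inj s M ≫ (f + g) ≫ T.proj s N)) =
      (R s).map ((R s).preimage (T.inj s M ≫ f ≫ T.proj s N) +
        (R s).preimage (T.inj s M ≫ g ≫ T.proj s N))
    simp)

lemma functor_linear (𝕜 : Type w) [Field 𝕜] [Linear 𝕜 D] [∀ s, Preadditive (B s)]
    [∀ s, Linear 𝕜 (B s)] [∀ s, (R s).Additive] [∀ s, (R s).Linear 𝕜] :
    T.functor.Linear 𝕜 where
  map_smul {M N} f r := funext fun s => (R s).map_injective (by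
    change (R s).map ((R s).preimage (T.inj s M ≫ (r • f) ≫ T.proj s N)) =
      (R s).map (r • (R s).preimage (T.inj s M ≫ f ≫ T.proj s N))
    simp)

end BlockDecomposition

end Blocks

/-! ### Products of algebras -/

section Products

variable {C : Type u} [Category.{v} C] [MonoidalCategory C]

/-- An endomorphism of the object underlying an algebra is central if it is linear for left and
right multiplication. -/
structure IsCentral (A : Mon C) (z : A.X ⟶ A.X) : Prop where
  left : A.X ◁ z ≫ μ[A.X] = μ[A.X] ≫ z
  right : z ▷ A.X ≫ μ[A.X] = μ[A.X] ≫ z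

lemma isCentral_id (A : Mon C) : IsCentral A (𝟙 A.X) := ⟨by simp, by simp⟩

lemma IsCentral.comp {A : Mon C} {z z' : A.X ⟶ A.X} (h : IsCentral A z) (h' : IsCentral A z') :
    IsCentral A (z ≫ z') :=
  ⟨by rw [whiskerLeft_comp, Category.assoc, h'.left, reassoc_of% h.left],
    by rw [comp_whiskerRight, Category.assoc, h'.right, reassoc_of% h.right]⟩

lemma IsCentral.one_left {A : Mon C} {z : A.X ⟶ A.X} (h : IsCentral A z) :
    (ρ_ A.X).inv ≫ A.X ◁ (η[A.X] ≫ z) ≫ μ[A.X] = z := by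
  rw [whiskerLeft_comp, Category.assoc, h.left, MonObj.mul_one_assoc, Iso.inv_hom_id_assoc]

lemma IsCentral.one_right {A : Mon C} {z : A.X ⟶ A.X} (h : IsCentral A z) :
    (λ_ A.X).inv ≫ (η[A.X] ≫ z) ▷ A.X ≫ μ[A.X] = z := by
  rw [comp_whiskerRight, Category.assoc, h.right, MonObj.one_mul_assoc, Iso.inv_hom_id_assoc]

variable [Preadditive C]

/-- A decomposition of an algebra `L` as a product of algebras `L' s`, given by projections and
inclusions onto complementary two-sided ideals. -/
structure ProductDecomposition (L : Mon C) {S : Type*} [Fintype S] (L' : S → Mon C) where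
  p : ∀ s, L ⟶ L' s
  i : ∀ s, (L' s).X ⟶ L.X
  i_p : ∀ s, i s ≫ (p s).hom = 𝟙 _
  i_p_of_ne : ∀ {s t}, s ≠ t → i s ≫ (p t).hom = 0
  sum_p_i : ∑ s, (p s).hom ≫ i s = 𝟙 L.X
  central : ∀ s, IsCentral L ((p s).hom ≫ i s)

namespace ProductDecomposition

variable {L : Mon C} {S : Type*} [Fintype S] {L' : S → Mon C} (T : ProductDecomposition L L')

/-- The idempotent of a product decomposition corresponding to a factor. -/
def e (s : S) : L.X ⟶ L.X := (T.p s).hom ≫ T.i s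

lemma e_central (s : S) : IsCentral L (T.e s) := T.central s

lemma e_p (s : S) : T.e s ≫ (T.p s).hom = (T.p s).hom := by
  rw [e, Category.assoc, T.i_p, Category.comp_id]

lemma i_e (s : S) : T.i s ≫ T.e s = T.i s := by
  rw [e, reassoc_of% T.i_p]

lemma e_e (s : S) : T.e s ≫ T.e s = T.e s := by
  rw [e, Category.assoc, reassoc_of% T.i_p]

lemma e_e_of_ne {s t : S} (h : s ≠ t) : T.e s ≫ T.e t = 0 := by
  rw [e, e, Category.assoc, reassoc_of% T.i_p_of_ne h, zero_comp, comp_zero]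

lemma sum_e : ∑ s, T.e s = 𝟙 L.X := T.sum_p_i

lemma one_i (s : S) : η[(L' s).X] ≫ T.i s = η[L.X] ≫ T.e s := by
  rw [e, IsMonHom.one_hom_assoc]

lemma mul_i (s : S) : μ[(L' s).X] ≫ T.i s = (T.i s ⊗ₘ T.i s) ≫ μ[L.X] := by
  have h : (T.i s ⊗ₘ T.i s) ≫ μ[L.X] ≫ T.e s = (T.i s ⊗ₘ T.i s) ≫ μ[L.X] := by
    rw [← (T.e_central s).left, MonoidalCategory.tensorHom_def, Category.assoc,
      ← whiskerLeft_comp_assoc, T.i_e, Category.assoc]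
  rw [← h, e, IsMonHom.mul_hom_assoc, ← Category.assoc,
    MonoidalCategory.tensorHom_comp_tensorHom, T.i_p, MonoidalCategory.id_tensorHom_id,
    Category.id_comp]

lemma hom_ext {X : C} {f g : X ⟶ L.X} (h : ∀ s, f ≫ (T.p s).hom = g ≫ (T.p s).hom) : f = g := by
  rw [← Category.comp_id f, ← Category.comp_id g, ← T.sum_p_i, Preadditive.comp_sum,
    Preadditive.comp_sum]
  exact Finset.sum_congr rfl fun s _ => by rw [← Category.assoc, h, Category.assoc]

lemma sum_comp_p {X : C} (f : ∀ s, X ⟶ (L' s).X) (t : S) :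
    (∑ s, f s ≫ T.i s) ≫ (T.p t).hom = f t := by
  classical
  rw [Preadditive.sum_comp, Finset.sum_eq_single t]
  · rw [Category.assoc, T.i_p, Category.comp_id]
  · intro s _ hs
    rw [Category.assoc, T.i_p_of_ne hs, comp_zero]
  · simp

/-- A decomposed algebra is the product of its factors. -/
def isLimitFan : IsLimit (Fan.mk L T.p) :=
  Fan.IsLimit.mk _
    (fun c =>
      Mon.Hom.mk' (∑ s, (c.proj s).hom ≫ T.i s)
        (T.hom_ext fun s => by
          rw [Category.assoc, T.sum_comp_p, IsMonHom.one_hom, IsMonHom.one_hom])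
        (T.hom_ext fun s => by
          rw [Category.assoc, T.sum_comp_p, Category.assoc, IsMonHom.mul_hom (T.p s).hom,
            ← Category.assoc (_ ⊗ₘ _), MonoidalCategory.tensorHom_comp_tensorHom, T.sum_comp_p,
            IsMonHom.mul_hom (c.proj s).hom]))
    (fun c s => Mon.Hom.ext (T.sum_comp_p (fun s => (c.proj s).hom) s))
    (fun c m hm => Mon.Hom.ext (T.hom_ext fun s => by
      refine Eq.trans ?_ (T.sum_comp_p (fun s => (c.proj s).hom) s).symm
      exact congrArg Mon.Hom.hom (hm s)))

end ProductDecomposition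

end Products

/-! ### Right modules over a product of algebras -/

namespace RightMod

variable {C : Type u} [Category.{v} C] [MonoidalCategory C]

section Basic

variable {A : Mon C}

lemma act_cancel (M : RightMod A) {X : C} {f g : M.X ⟶ X} (h : M.act ≫ f = M.act ≫ g) : f = g := by
  have h' := congrArg (fun t => (ρ_ M.X).inv ≫ M.X ◁ η[A.X] ≫ t) h
  simpa only [← Category.assoc (M.X ◁ η[A.X]), M.act_one, Iso.inv_hom_id_assoc] using h'

/-- The action of a central endomorphism of `A` on a right `A`-module. -/
def mulCentral (M : RightMod A) (z : A.X ⟶ A.X) : M.X ⟶ M.X :=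
  (ρ_ M.X).inv ≫ M.X ◁ (η[A.X] ≫ z) ≫ M.act

lemma act_mulCentral (M : RightMod A) {z : A.X ⟶ A.X} (h : IsCentral A z) :
    M.act ≫ M.mulCentral z = M.X ◁ z ≫ M.act := by
  conv_rhs => rw [← h.one_left, whiskerLeft_comp, whiskerLeft_comp, Category.assoc, Category.assoc,
    M.assoc]
  rw [mulCentral, rightUnitor_inv_naturality_assoc, ← whisker_exchange_assoc]
  simp

lemma mulCentral_act (M : RightMod A) {z : A.X ⟶ A.X} (h : IsCentral A z) :
    M.mulCentral z ▷ A.X ≫ M.act = M.X ◁ z ≫ M.act := by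
  conv_rhs => rw [← h.one_right, whiskerLeft_comp, whiskerLeft_comp, Category.assoc, Category.assoc,
    M.assoc]
  simp [mulCentral]

lemma mulCentral_eq {M : RightMod A} {z : A.X ⟶ A.X} (h : IsCentral A z) {f : M.X ⟶ M.X}
    (hf : M.act ≫ f = M.X ◁ z ≫ M.act) : M.mulCentral z = f :=
  M.act_cancel ((M.act_mulCentral h).trans hf.symm)

lemma mulCentral_naturality {M N : RightMod A} (f : M ⟶ N) (z : A.X ⟶ A.X) :
    M.mulCentral z ≫ f.hom = f.hom ≫ N.mulCentral z := by
  simp only [mulCentral, Category.assoc, f.act_hom, whisker_exchange_assoc,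
    ← rightUnitor_inv_naturality_assoc]

lemma mulCentral_id (M : RightMod A) : M.mulCentral (𝟙 A.X) = 𝟙 M.X :=
  mulCentral_eq (isCentral_id A) (by simp)

lemma mulCentral_comp (M : RightMod A) {z z' : A.X ⟶ A.X} (h : IsCentral A z)
    (h' : IsCentral A z') : M.mulCentral (z ≫ z') = M.mulCentral z ≫ M.mulCentral z' :=
  mulCentral_eq (h.comp h') (by
    rw [reassoc_of% M.act_mulCentral h, act_mulCentral _ h', whiskerLeft_comp_assoc])

/-- The action of a central endomorphism as an endomorphism of modules. -/
@[simps]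
def mulCentralHom (M : RightMod A) {z : A.X ⟶ A.X} (h : IsCentral A z) : M ⟶ M :=
  ⟨M.mulCentral z, by rw [act_mulCentral _ h, mulCentral_act _ h]⟩

/-- Idempotents split in the category of right modules. -/
lemma exists_split [IsIdempotentComplete C] (M : RightMod A) (e : M ⟶ M) (he : e ≫ e = e) :
    ∃ (N : RightMod A) (i : N ⟶ M) (q : M ⟶ N), i ≫ q = 𝟙 N ∧ q ≫ i = e := by
  obtain ⟨X, i, q, hiq, hqi⟩ :=
    IsIdempotentComplete.idempotents_split M.X e.hom (congrArg Hom.hom he)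
  have hi : i ≫ e.hom = i := by rw [← hqi, reassoc_of% hiq]
  have hq : e.hom ≫ q = q := by rw [← hqi, Category.assoc, hiq, Category.comp_id]
  have ha : M.act ≫ q ≫ i = (q ≫ i) ▷ A.X ≫ M.act := by rw [hqi, e.act_hom]
  have h₁ : (i ▷ A.X ≫ M.act ≫ q) ≫ i = i ▷ A.X ≫ M.act := by
    rw [Category.assoc, Category.assoc, ha, ← comp_whiskerRight_assoc, hqi, hi]
  have h₂ : q ▷ A.X ≫ i ▷ A.X ≫ M.act ≫ q = M.act ≫ q := by
    rw [← comp_whiskerRight_assoc, hqi, ← reassoc_of% e.act_hom, hq]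
  let N : RightMod A :=
    { X := X
      act := i ▷ A.X ≫ M.act ≫ q
      act_one := by
        rw [whisker_exchange_assoc, reassoc_of% M.act_one, rightUnitor_naturality_assoc, hiq,
          Category.comp_id]
      assoc := by
        rw [whisker_exchange_assoc, reassoc_of% M.assoc, ← comp_whiskerRight_assoc _ i, h₁]
        simp }
  exact ⟨N, ⟨i, h₁⟩, ⟨q, h₂.symm⟩, hom_ext _ _ hiq, hom_ext _ _ hqi⟩

section Preadditive

variable [Preadditive C] [MonoidalPreadditive C]

lemma mulCentral_zero (M : RightMod A) : M.mulCentral (0 : A.X ⟶ A.X) = 0 := by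
  simp [mulCentral]

lemma mulCentral_sum (M : RightMod A) {S : Type*} [Fintype S] (z : S → (A.X ⟶ A.X)) :
    M.mulCentral (∑ s, z s) = ∑ s, M.mulCentral (z s) := by
  simp only [mulCentral, Preadditive.comp_sum, whiskerLeft_sum, Preadditive.sum_comp]

/-- The additive functor from right modules to underlying objects. -/
@[simps]
def forget (A : Mon C) : RightMod A ⥤ C where
  obj M := M.X
  map f := f.hom

instance : (forget A).Additive where

lemma sum_hom {M N : RightMod A} {S : Type*} [Fintype S] (f : S → (M ⟶ N)) :
    Hom.hom (∑ s, f s : M ⟶ N) = ∑ s, (f s).hom :=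
  (forget A).map_sum f Finset.univ

/-- Finite families of right modules have direct sums. -/
lemma exists_directSum [HasFiniteBiproducts C] {S : Type} [Fintype S] (M : S → RightMod A) :
    ∃ (N : RightMod A) (i : ∀ s, M s ⟶ N) (q : ∀ s, N ⟶ M s),
      (∀ s, i s ≫ q s = 𝟙 _) ∧ ∑ s, q s ≫ i s = 𝟙 N := by
  classical
  let X : C := ⨁ fun s => (M s).X
  let i : ∀ s, (M s).X ⟶ X := biproduct.ι fun s => (M s).X
  let q : ∀ s, X ⟶ (M s).X := biproduct.π fun s => (M s).X
  let a : X ⊗ A.X ⟶ X := ∑ s, q s ▷ A.X ≫ (M s).act ≫ i s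
  have hiq : ∀ s, i s ≫ q s = 𝟙 _ := fun s => biproduct.ι_π_self _ s
  have hne : ∀ {s t}, s ≠ t → i s ≫ q t = 0 := fun h => biproduct.ι_π_ne _ h
  have haq : ∀ s, a ≫ q s = q s ▷ A.X ≫ (M s).act := fun s => by
    rw [Preadditive.sum_comp, Finset.sum_eq_single s]
    · rw [Category.assoc, Category.assoc, hiq, Category.comp_id]
    · intro t _ ht
      rw [Category.assoc, Category.assoc, hne ht, comp_zero, comp_zero]
    · simp
  have hia : ∀ s, i s ▷ A.X ≫ a = (M s).act ≫ i s := fun s => by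
    rw [Preadditive.comp_sum, Finset.sum_eq_single s]
    · rw [← comp_whiskerRight_assoc, hiq, id_whiskerRight, Category.id_comp]
    · intro t _ ht
      rw [← comp_whiskerRight_assoc, hne ht.symm, MonoidalPreadditive.zero_whiskerRight, zero_comp]
    · simp
  let N : RightMod A :=
    { X := X
      act := a
      act_one := biproduct.hom_ext _ _ fun s => by
        change (_ ≫ a) ≫ q s = _ ≫ q s
        rw [Category.assoc, haq, whisker_exchange_assoc, (M s).act_one, rightUnitor_naturality]
      assoc := biproduct.hom_ext _ _ fun s => by
        change (_ ≫ a) ≫ q s = (_ ≫ _ ≫ a) ≫ q s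
        rw [Category.assoc, Category.assoc, Category.assoc, haq, whisker_exchange_assoc, (M s).assoc,
          ← comp_whiskerRight_assoc, haq]
        simp }
  exact ⟨N, fun s => ⟨i s, (hia s).symm⟩, fun s => ⟨q s, haq s⟩, fun s => hom_ext _ _ (hiq s),
    hom_ext _ _ ((sum_hom _).trans biproduct.total)⟩

end Preadditive

end Basic

/-- Restriction of scalars of right modules. -/
@[simps]
def restrictObj {A A' : Mon C} (f : A ⟶ A') (M : RightMod A') : RightMod A where
  X := M.X
  act := M.X ◁ f.hom ≫ M.act
  act_one := by rw [← whiskerLeft_comp_assoc, IsMonHom.one_hom, M.act_one]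
  assoc := by
    have h : (M.X ⊗ A'.X) ◁ f.hom ≫ M.act ▷ A'.X = M.act ▷ A.X ≫ M.X ◁ f.hom :=
      whisker_exchange _ _
    rw [← whiskerLeft_comp_assoc, IsMonHom.mul_hom, whiskerLeft_comp_assoc, M.assoc,
      comp_whiskerRight, Category.assoc, ← reassoc_of% h, MonoidalCategory.tensorHom_def]
    simp

/-- Restriction of scalars of right modules as a functor. -/
@[simps]
def restrict {A A' : Mon C} (f : A ⟶ A') : RightMod A' ⥤ RightMod A where
  obj M := restrictObj f M
  map {M N} h := ⟨h.hom, by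
    change (M.X ◁ f.hom ≫ M.act) ≫ h.hom = h.hom ▷ A.X ≫ N.X ◁ f.hom ≫ N.act
    rw [Category.assoc, h.act_hom, whisker_exchange_assoc]⟩

instance {A A' : Mon C} (f : A ⟶ A') : (restrict f).Faithful where
  map_injective h := hom_ext _ _ (congrArg (fun k => Hom.hom k) h :)

instance [Preadditive C] [MonoidalPreadditive C] {A A' : Mon C} (f : A ⟶ A') :
    (restrict f).Additive where

instance [Preadditive C] [MonoidalPreadditive C] (𝕜 : Type w) [Field 𝕜] [Linear 𝕜 C]
    [MonoidalLinear 𝕜 C] {A A' : Mon C} (f : A ⟶ A') : (restrict f).Linear 𝕜 where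

lemma restrict_full {A A' : Mon C} (f : A ⟶ A') (i : A'.X ⟶ A.X) (h : i ≫ f.hom = 𝟙 _) :
    (restrict f).Full where
  map_surjective {M N} g := by
    let g' : M.X ⟶ N.X := g.hom
    refine ⟨⟨g', ?_⟩, rfl⟩
    have hg : (M.X ◁ f.hom ≫ M.act) ≫ g' = g' ▷ A.X ≫ N.X ◁ f.hom ≫ N.act := g.act_hom
    have := congrArg (fun t => M.X ◁ i ≫ t) hg
    simpa only [Category.assoc, ← whisker_exchange_assoc, ← whiskerLeft_comp_assoc, h,
      whiskerLeft_id, Category.id_comp] using this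

end RightMod

section LeftLinear

open Functor.LaxLeftLinear

/-- A lax linear functor with invertible comparison morphisms is linear. -/
@[reducible]
def leftLinearOfLax {C : Type u} [Category.{v} C] [MonoidalCategory C] {M : Type u₁}
    [Category.{v₁} M] [MonoidalLeftAction C M] {N : Type u₂} [Category.{v₂} N]
    [MonoidalLeftAction C N] (F : M ⥤ N) [F.LaxLeftLinear C]
    (δ : ∀ (c : C) (m : M), F.obj (c ⊙ₗ m) ⟶ c ⊙ₗ F.obj m)
    (h : ∀ (c : C) (m : M), μₗ F c m ≫ δ c m = 𝟙 _)
    (h' : ∀ (c : C) (m : M), δ c m ≫ μₗ F c m = 𝟙 _) : F.LeftLinear C where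
  δₗ := δ
  μₗ_comp_δₗ := h
  δₗ_comp_μₗ := h'
  δₗ_naturality_left f m := by
    rw [← Category.id_comp (F.map _), ← h', Category.assoc, Category.assoc, ← μₗ_naturality_left_assoc,
      h, Category.comp_id]
  δₗ_naturality_right c m m' f := by
    rw [← Category.id_comp (F.map _), ← h', Category.assoc, Category.assoc, ← μₗ_naturality_right_assoc,
      h, Category.comp_id]
  δₗ_associativity c c' m := by
    rw [← Category.id_comp (F.map _ ≫ _), ← h', Category.assoc, μₗ_associativity_assoc,
      reassoc_of% h, ← MonoidalLeftAction.actionHomRight_comp, h,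
      MonoidalLeftAction.actionHomRight_id, Category.comp_id]
  δₗ_unitality_inv m := by
    rw [← μₗ_unitality_inv, Category.assoc, h, Category.comp_id]

end LeftLinear

section TensorObj

variable {C : Type u} [Category.{v} C] [MonoidalCategory C]

namespace RightMod

lemma mulCentral_tensorObj {A : Mon C} (c : C) (M : RightMod A) {z : A.X ⟶ A.X}
    (h : IsCentral A z) : (tensorObj c M).mulCentral z = c ◁ M.mulCentral z :=
  mulCentral_eq h (by
    change ((α_ c M.X A.X).hom ≫ c ◁ M.act) ≫ c ◁ M.mulCentral z =
      (c ⊗ M.X) ◁ z ≫ (α_ c M.X A.X).hom ≫ c ◁ M.act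
    rw [Category.assoc, ← whiskerLeft_comp, act_mulCentral _ h]
    simp)

/-- Restriction of scalars commutes with the action of `C`. -/
def restrictTensorIso {A A' : Mon C} (f : A ⟶ A') (c : C) (M : RightMod A') :
    tensorObj c (restrictObj f M) ≅ restrictObj f (tensorObj c M) :=
  isoMk (Iso.refl (c ⊗ M.X)) (by
    change ((α_ c M.X A.X).hom ≫ c ◁ (M.X ◁ f.hom ≫ M.act)) ≫ 𝟙 (c ⊗ M.X) =
      𝟙 (c ⊗ M.X) ▷ A.X ≫ (c ⊗ M.X) ◁ f.hom ≫ (α_ c M.X A'.X).hom ≫ c ◁ M.act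
    simp)

end RightMod

end TensorObj

section RightBlocks

variable {C : Type u} [Category.{v} C] [Abelian C] [MonoidalCategory C]
  {L : Mon C} {S : Type} [Fintype S] {L' : S → Mon C} (T : ProductDecomposition L L')

namespace RightMod

/-- A right `L`-module on which the idempotent of a factor of `L` acts as the identity is a module
over this factor. -/
lemma exists_restrict_iso (s : S) (M : RightMod L) (h : M.mulCentral (T.e s) = 𝟙 M.X) :
    ∃ N : RightMod (L' s), Nonempty ((restrict (T.p s)).obj N ≅ M) := by
  have ha : M.X ◁ T.e s ≫ M.act = M.act := by
    rw [← act_mulCentral _ (T.e_central s), h, Category.comp_id]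
  let N : RightMod (L' s) :=
    { X := M.X
      act := M.X ◁ T.i s ≫ M.act
      act_one := by
        rw [← whiskerLeft_comp_assoc, T.one_i, whiskerLeft_comp_assoc, ha, M.act_one]
      assoc := by
        rw [← whiskerLeft_comp_assoc, T.mul_i, whiskerLeft_comp_assoc, M.assoc,
          MonoidalCategory.tensorHom_def]
        simp [← whisker_exchange_assoc] }
  refine ⟨N, ⟨isoMk (Iso.refl M.X) ?_⟩⟩
  change (M.X ◁ (T.p s).hom ≫ M.X ◁ T.i s ≫ M.act) ≫ 𝟙 M.X = 𝟙 M.X ▷ L.X ≫ M.act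
  rw [← whiskerLeft_comp_assoc]
  simpa [ProductDecomposition.e] using ha

lemma exists_component (s : S) (M : RightMod L) :
    ∃ (N : RightMod (L' s)) (i : (restrict (T.p s)).obj N ⟶ M)
      (q : M ⟶ (restrict (T.p s)).obj N), i ≫ q = 𝟙 _ ∧
        q ≫ i = M.mulCentralHom (T.e_central s) := by
  obtain ⟨K, i, q, hiq, hqi⟩ := M.exists_split (M.mulCentralHom (T.e_central s))
    (hom_ext _ _ (by
      change M.mulCentral _ ≫ M.mulCentral _ = M.mulCentral _
      rw [← mulCentral_comp _ (T.e_central s) (T.e_central s), T.e_e]))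
  have h : K.mulCentral (T.e s) = 𝟙 K.X := by
    have h₁ : i.hom ≫ q.hom = 𝟙 K.X := congrArg (fun k => Hom.hom k) hiq
    have h₂ : q.hom ≫ i.hom = M.mulCentral (T.e s) := congrArg (fun k => Hom.hom k) hqi
    rw [← Category.comp_id (K.mulCentral _), ← h₁, reassoc_of% mulCentral_naturality, ← h₂,
      Category.assoc, h₁, Category.comp_id, h₁]
  obtain ⟨N, ⟨f⟩⟩ := exists_restrict_iso T s K h
  refine ⟨N, f.hom ≫ i, q ≫ f.inv, ?_, ?_⟩
  · rw [Category.assoc, reassoc_of% hiq, f.hom_inv_id]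
  · rw [Category.assoc, f.inv_hom_id_assoc, hqi]

end RightMod

open RightMod

namespace ProductDecomposition

variable [MonoidalPreadditive C]

/-- The block decomposition of the category of right modules over a product of algebras. -/
noncomputable def rightBlocks : BlockDecomposition fun s => RightMod.restrict (T.p s) where
  E s M := M.mulCentralHom (T.e_central s)
  natural s _ _ f := RightMod.hom_ext _ _ (mulCentral_naturality f _)
  sum_E M := RightMod.hom_ext _ _ (by
    rw [sum_hom]
    change ∑ s, M.mulCentral (T.e s) = 𝟙 M.X
    rw [← mulCentral_sum, T.sum_e, mulCentral_id])
  orthogonal {s t} h M := RightMod.hom_ext _ _ (by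
    change M.mulCentral (T.e s) ≫ M.mulCentral (T.e t) = 0
    rw [← mulCentral_comp _ (T.e_central s) (T.e_central t), T.e_e_of_ne h, mulCentral_zero])
  E_obj s X := RightMod.hom_ext _ _ (mulCentral_eq (T.e_central s) (by
    change (X.X ◁ (T.p s).hom ≫ X.act) ≫ 𝟙 X.X = X.X ◁ T.e s ≫ X.X ◁ (T.p s).hom ≫ X.act
    rw [← whiskerLeft_comp_assoc, T.e_p, Category.comp_id]))
  obj s M := (exists_component T s M).choose
  inj s M := (exists_component T s M).choose_spec.choose
  proj s M := (exists_component T s M).choose_spec.choose_spec.choose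
  inj_proj s M := (exists_component T s M).choose_spec.choose_spec.choose_spec.1
  proj_inj s M := (exists_component T s M).choose_spec.choose_spec.choose_spec.2
  exists_sum X :=
    have : HasFiniteBiproducts C := Abelian.hasFiniteBiproducts
    exists_directSum fun s => (RightMod.restrict (T.p s)).obj (X s)

instance (s : S) : (RightMod.restrict (T.p s)).Full := restrict_full _ (T.i s) (T.i_p s)

/-- The component of a right `L`-module corresponding to a factor of `L`. -/
noncomputable def component (s : S) (M : RightMod L) : RightMod (L' s) := T.rightBlocks.obj s M

/-- The inclusion of a component. -/
noncomputable def compInj (s : S) (M : RightMod L) : (T.component s M).X ⟶ M.X :=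
  (T.rightBlocks.inj s M).hom

/-- The projection to a component. -/
noncomputable def compProj (s : S) (M : RightMod L) : M.X ⟶ (T.component s M).X :=
  (T.rightBlocks.proj s M).hom

lemma compInj_compProj (s : S) (M : RightMod L) : T.compInj s M ≫ T.compProj s M = 𝟙 _ :=
  congrArg (fun k => Hom.hom k) (T.rightBlocks.inj_proj s M)

lemma compProj_compInj (s : S) (M : RightMod L) :
    T.compProj s M ≫ T.compInj s M = M.mulCentral (T.e s) :=
  congrArg (fun k => Hom.hom k) (T.rightBlocks.proj_inj s M)

lemma compInj_act (s : S) (M : RightMod L) :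
    ((T.component s M).X ◁ (T.p s).hom ≫ (T.component s M).act) ≫ T.compInj s M =
      T.compInj s M ▷ L.X ≫ M.act :=
  (T.rightBlocks.inj s M).act_hom

instance (s : S) (M : RightMod L) : Mono (T.compInj s M) :=
  mono_of_mono_fac (T.compInj_compProj s M)

lemma compInj_mulCentral (s : S) (M : RightMod L) :
    T.compInj s M ≫ M.mulCentral (T.e s) = T.compInj s M := by
  rw [← compProj_compInj, reassoc_of% T.compInj_compProj]

/-- The inclusion of a component of `c ⊗ M`. -/
noncomputable def tensorInj (s : S) (c : C) (M : RightMod L) :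
    (T.component s (tensorObj c M)).X ⟶ c ⊗ M.X :=
  T.compInj s (tensorObj c M)

/-- The projection to a component of `c ⊗ M`. -/
noncomputable def tensorProj (s : S) (c : C) (M : RightMod L) :
    c ⊗ M.X ⟶ (T.component s (tensorObj c M)).X :=
  T.compProj s (tensorObj c M)

lemma tensorInj_tensorProj (s : S) (c : C) (M : RightMod L) :
    T.tensorInj s c M ≫ T.tensorProj s c M = 𝟙 _ :=
  T.compInj_compProj s (tensorObj c M)

lemma tensorProj_tensorInj (s : S) (c : C) (M : RightMod L) :
    T.tensorProj s c M ≫ T.tensorInj s c M = c ◁ M.mulCentral (T.e s) :=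
  (T.compProj_compInj s (tensorObj c M)).trans (mulCentral_tensorObj _ _ (T.e_central s))

lemma tensorInj_mulCentral (s : S) (c : C) (M : RightMod L) :
    T.tensorInj s c M ≫ c ◁ M.mulCentral (T.e s) = T.tensorInj s c M := by
  rw [← tensorProj_tensorInj, reassoc_of% T.tensorInj_tensorProj]

lemma tensorInj_act (s : S) (c : C) (M : RightMod L) :
    ((T.component s (tensorObj c M)).X ◁ (T.p s).hom ≫ (T.component s (tensorObj c M)).act) ≫
      T.tensorInj s c M = T.tensorInj s c M ▷ L.X ≫ (α_ c M.X L.X).hom ≫ c ◁ M.act :=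
  T.compInj_act s (tensorObj c M)

instance (s : S) (c : C) (M : RightMod L) : Mono (T.tensorInj s c M) :=
  mono_of_mono_fac (T.tensorInj_tensorProj s c M)

/-- The action of `C` commutes with taking components, in `C`. -/
@[simps]
noncomputable def tensorCompIso (s : S) (c : C) (M : RightMod L) :
    c ⊗ (T.component s M).X ≅ (T.component s (tensorObj c M)).X where
  hom := c ◁ T.compInj s M ≫ T.tensorProj s c M
  inv := T.tensorInj s c M ≫ c ◁ T.compProj s M
  hom_inv_id := by
    rw [Category.assoc, reassoc_of% T.tensorProj_tensorInj, ← whiskerLeft_comp, ← whiskerLeft_comp,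
      ← Category.assoc (T.compInj s M), compInj_mulCentral, compInj_compProj, whiskerLeft_id]
  inv_hom_id := by
    rw [Category.assoc, ← whiskerLeft_comp_assoc, compProj_compInj,
      reassoc_of% T.tensorInj_mulCentral, tensorInj_tensorProj]

lemma tensorCompIso_hom_tensorInj (s : S) (c : C) (M : RightMod L) :
    (T.tensorCompIso s c M).hom ≫ T.tensorInj s c M = c ◁ T.compInj s M := by
  rw [tensorCompIso_hom, Category.assoc, tensorProj_tensorInj, ← whiskerLeft_comp,
    compInj_mulCentral]

lemma tensorCompIso_act (s : S) (c : C) (M : RightMod L) :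
    ((c ⊗ (T.component s M).X) ◁ (T.p s).hom ≫ (α_ c (T.component s M).X (L' s).X).hom ≫
      c ◁ (T.component s M).act) ≫ (T.tensorCompIso s c M).hom =
      (T.tensorCompIso s c M).hom ▷ L.X ≫ (T.component s (tensorObj c M)).X ◁ (T.p s).hom ≫
        (T.component s (tensorObj c M)).act := by
  rw [← cancel_mono (T.tensorInj s c M), Category.assoc ((T.tensorCompIso s c M).hom ▷ L.X),
    T.tensorInj_act, ← comp_whiskerRight_assoc, Category.assoc, tensorCompIso_hom_tensorInj]
  have h := congrArg (fun t => (α_ c (T.component s M).X L.X).hom ≫ c ◁ t) (T.compInj_act s M)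
  simpa using h

/-- The action of `C` commutes with taking components, as an isomorphism of `L`-modules. -/
noncomputable def restrictLineator (s : S) (c : C) (M : RightMod L) :
    (RightMod.restrict (T.p s)).obj (tensorObj c (T.component s M)) ≅
      (RightMod.restrict (T.p s)).obj (T.component s (tensorObj c M)) :=
  isoMk (T.tensorCompIso s c M) (T.tensorCompIso_act s c M)

/-- The action of `C` commutes with taking components. -/
noncomputable def lineator (s : S) (c : C) (M : RightMod L) :
    tensorObj c (T.component s M) ≅ T.component s (tensorObj c M) :=
  (RightMod.restrict (T.p s)).preimageIso (T.restrictLineator s c M)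

/-- The morphism in `C` underlying `lineator`. -/
noncomputable def lineatorHom (s : S) (c : C) (M : RightMod L) :
    c ⊗ (T.component s M).X ⟶ (T.component s (tensorObj c M)).X :=
  (T.lineator s c M).hom.hom

lemma lineatorHom_tensorInj (s : S) (c : C) (M : RightMod L) :
    T.lineatorHom s c M ≫ T.tensorInj s c M = c ◁ T.compInj s M := by
  have h := (RightMod.restrict (T.p s)).map_preimage (T.restrictLineator s c M).hom
  have h' : T.lineatorHom s c M = (T.tensorCompIso s c M).hom := congrArg (fun k => Hom.hom k) h
  rw [h', tensorCompIso_hom_tensorInj]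

/-- The morphism in `C` underlying the map induced on components. -/
noncomputable def compMap {M N : RightMod L} (f : M ⟶ N) (s : S) :
    (T.component s M).X ⟶ (T.component s N).X :=
  (T.rightBlocks.functor.map f s).hom

lemma compMap_compInj {M N : RightMod L} (f : M ⟶ N) (s : S) :
    T.compMap f s ≫ T.compInj s N = T.compInj s M ≫ f.hom :=
  congrArg (fun k => Hom.hom k) ((T.rightBlocks.incl s).naturality f)

/-- Taking components is a lax functor of `C`-module categories. -/
noncomputable instance : T.rightBlocks.functor.LaxLeftLinear C where
  μₗ c M := fun s => (T.lineator s c M).hom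
  μₗ_naturality_left {c c'} f M := funext fun s => RightMod.hom_ext _ _ (by
    let k : c ⊗ M.X ⟶ c' ⊗ M.X := f ▷ M.X
    have h : T.compMap (f ⊵ₗ M) s ≫ T.tensorInj s c' M = T.tensorInj s c M ≫ k :=
      T.compMap_compInj (f ⊵ₗ M) s
    change f ▷ (T.component s M).X ≫ T.lineatorHom s c' M =
      T.lineatorHom s c M ≫ T.compMap (f ⊵ₗ M) s
    rw [← cancel_mono (T.tensorInj s c' M), Category.assoc, Category.assoc, lineatorHom_tensorInj]
    erw [h]
    rw [reassoc_of% T.lineatorHom_tensorInj, whisker_exchange])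
  μₗ_naturality_right c {M N} f := funext fun s => RightMod.hom_ext _ _ (by
    have h : T.compMap (c ⊴ₗ f) s ≫ T.tensorInj s c N = T.tensorInj s c M ≫ c ◁ f.hom :=
      T.compMap_compInj (c ⊴ₗ f) s
    change c ◁ T.compMap f s ≫ T.lineatorHom s c N = T.lineatorHom s c M ≫ T.compMap (c ⊴ₗ f) s
    rw [← cancel_mono (T.tensorInj s c N), Category.assoc, Category.assoc, lineatorHom_tensorInj]
    erw [h]
    rw [reassoc_of% T.lineatorHom_tensorInj, ← whiskerLeft_comp, ← whiskerLeft_comp,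
      compMap_compInj])
  μₗ_associativity c c' M := funext fun s => RightMod.hom_ext _ _ (by
    have h : T.compMap (αₗ c c' M).hom s ≫ T.tensorInj s c (tensorObj c' M) =
        T.tensorInj s (c ⊗ c') M ≫ (α_ c c' M.X).hom :=
      T.compMap_compInj (αₗ c c' M).hom s
    have h' : c ◁ T.lineatorHom s c' M ≫ c ◁ T.compInj s (tensorObj c' M) =
        c ◁ c' ◁ T.compInj s M := by
      rw [← whiskerLeft_comp, ← lineatorHom_tensorInj]
      rfl
    change T.lineatorHom s (c ⊗ c') M ≫ T.compMap (αₗ c c' M).hom s =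
      (α_ c c' (T.component s M).X).hom ≫ c ◁ T.lineatorHom s c' M ≫
        T.lineatorHom s c (tensorObj c' M)
    rw [← cancel_mono (T.tensorInj s c (tensorObj c' M)), Category.assoc, Category.assoc,
      Category.assoc, lineatorHom_tensorInj, h']
    erw [h]
    refine ((reassoc_of% T.lineatorHom_tensorInj s (c ⊗ c') M) (α_ c c' M.X).hom).trans ?_
    exact associator_naturality_right _ _ _)
  μₗ_unitality M := funext fun s => RightMod.hom_ext _ _ (by
    have h : T.compMap (λₗ[C] M).hom s ≫ T.compInj s M = T.tensorInj s (𝟙_ C) M ≫ (λ_ M.X).hom :=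
      T.compMap_compInj (λₗ[C] M).hom s
    change (λ_ (T.component s M).X).hom = T.lineatorHom s (𝟙_ C) M ≫ T.compMap (λₗ[C] M).hom s
    rw [← cancel_mono (T.compInj s M), Category.assoc]
    erw [h]
    rw [reassoc_of% T.lineatorHom_tensorInj, leftUnitor_naturality])

/-- The category of right modules over a product of algebras is the direct sum of the categories
of modules over the factors, as a `C`-module category. -/
noncomputable def moduleEquivalence (𝕜 : Type w) [Field 𝕜] [Linear 𝕜 C] [MonoidalLinear 𝕜 C] :
    ModuleEquivalence 𝕜 C (RightMod L) (∀ s, RightMod (L' s)) where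
  equiv := T.rightBlocks.equivalence
  additive := T.rightBlocks.functor_additive
  linear := T.rightBlocks.functor_linear 𝕜
  leftLinear := leftLinearOfLax T.rightBlocks.functor (fun c M s => (T.lineator s c M).inv)
    (fun c M => funext fun s => (T.lineator s c M).hom_inv_id)
    (fun c M => funext fun s => (T.lineator s c M).inv_hom_id)

/-- A factor of an exact algebra is exact. -/
lemma isExactAlgebra (T : ProductDecomposition L L') (hL : IsExactAlgebra L) (s : S) :
    IsExactAlgebra (L' s) := fun P M hP =>
  T.rightBlocks.projective_of_map
    (Projective.of_iso (restrictTensorIso (T.p s) P M) (hL P (RightMod.restrictObj (T.p s) M) hP))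

end ProductDecomposition

end RightBlocks

/-! ### Bimodules over products of algebras -/

section BimodBasic

variable {C : Type u} [Category.{v} C] [MonoidalCategory C] {A B : Mon C}

/-- The right module underlying a bimodule. -/
@[simps]
def toRightMod (M : Bimod A B) : RightMod B where
  X := M.X
  act := M.actRight
  act_one := M.actRight_one
  assoc := M.right_assoc

/-- The right action of a central endomorphism of `B` on an `(A, B)`-bimodule. -/
def rmul (M : Bimod A B) (z : B.X ⟶ B.X) : M.X ⟶ M.X := (toRightMod M).mulCentral z

/-- The left action of a central endomorphism of `A` on an `(A, B)`-bimodule. -/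
def lmul (M : Bimod A B) (z : A.X ⟶ A.X) : M.X ⟶ M.X :=
  (λ_ M.X).inv ≫ (η[A.X] ≫ z) ▷ M.X ≫ M.actLeft

lemma rmul_def (M : Bimod A B) (z : B.X ⟶ B.X) :
    rmul M z = (ρ_ M.X).inv ≫ M.X ◁ (η[B.X] ≫ z) ≫ M.actRight := rfl

lemma actRight_rmul (M : Bimod A B) {z : B.X ⟶ B.X} (h : IsCentral B z) :
    M.actRight ≫ rmul M z = M.X ◁ z ≫ M.actRight :=
  (toRightMod M).act_mulCentral h

lemma rmul_actRight (M : Bimod A B) {z : B.X ⟶ B.X} (h : IsCentral B z) :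
    rmul M z ▷ B.X ≫ M.actRight = M.X ◁ z ≫ M.actRight :=
  (toRightMod M).mulCentral_act h

lemma rmul_eq {M : Bimod A B} {z : B.X ⟶ B.X} (h : IsCentral B z) {f : M.X ⟶ M.X}
    (hf : M.actRight ≫ f = M.X ◁ z ≫ M.actRight) : rmul M z = f :=
  RightMod.mulCentral_eq (M := toRightMod M) h hf

lemma rmul_naturality {M N : Bimod A B} (f : M ⟶ N) (z : B.X ⟶ B.X) :
    rmul M z ≫ f.hom = f.hom ≫ rmul N z := by
  simp only [rmul_def, Category.assoc, f.right_act_hom, whisker_exchange_assoc,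
    ← rightUnitor_inv_naturality_assoc]

lemma rmul_comp (M : Bimod A B) {z z' : B.X ⟶ B.X} (h : IsCentral B z)
    (h' : IsCentral B z') : rmul M (z ≫ z') = rmul M z ≫ rmul M z' :=
  (toRightMod M).mulCentral_comp h h'

lemma actLeft_rmul (M : Bimod A B) (z : B.X ⟶ B.X) :
    M.actLeft ≫ rmul M z = A.X ◁ rmul M z ≫ M.actLeft := by
  rw [rmul_def, rightUnitor_inv_naturality_assoc, ← whisker_exchange_assoc, M.middle_assoc]
  simp

lemma actLeft_cancel (M : Bimod A B) {X : C} {f g : M.X ⟶ X}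
    (h : M.actLeft ≫ f = M.actLeft ≫ g) : f = g := by
  have h' := congrArg (fun t => (λ_ M.X).inv ≫ η[A.X] ▷ M.X ≫ t) h
  simpa only [← Category.assoc (η[A.X] ▷ M.X), M.one_actLeft, Iso.inv_hom_id_assoc] using h'

lemma actLeft_lmul (M : Bimod A B) {z : A.X ⟶ A.X} (h : IsCentral A z) :
    M.actLeft ≫ lmul M z = A.X ◁ lmul M z ≫ M.actLeft := by
  have h₁ : M.actLeft ≫ lmul M z = z ▷ M.X ≫ M.actLeft := by
    conv_rhs => rw [← h.one_right, comp_whiskerRight, comp_whiskerRight, Category.assoc,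
      Category.assoc, M.left_assoc]
    rw [lmul, leftUnitor_inv_naturality_assoc, whisker_exchange_assoc]
    simp
  have h₂ : A.X ◁ lmul M z ≫ M.actLeft = z ▷ M.X ≫ M.actLeft := by
    conv_rhs => rw [← h.one_left, comp_whiskerRight, comp_whiskerRight, Category.assoc,
      Category.assoc, M.left_assoc]
    simp [lmul]
  rw [h₁, h₂]

lemma lmul_actLeft (M : Bimod A B) {z : A.X ⟶ A.X} (h : IsCentral A z) :
    A.X ◁ lmul M z ≫ M.actLeft = z ▷ M.X ≫ M.actLeft := by
  conv_rhs => rw [← h.one_left, comp_whiskerRight, comp_whiskerRight, Category.assoc,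
    Category.assoc, M.left_assoc]
  simp [lmul]

lemma lmul_eq {M : Bimod A B} {z : A.X ⟶ A.X} (h : IsCentral A z) {f : M.X ⟶ M.X}
    (hf : M.actLeft ≫ f = z ▷ M.X ≫ M.actLeft) : lmul M z = f :=
  actLeft_cancel M (((actLeft_lmul M h).trans (lmul_actLeft M h)).trans hf.symm)

lemma lmul_naturality {M N : Bimod A B} (f : M ⟶ N) (z : A.X ⟶ A.X) :
    lmul M z ≫ f.hom = f.hom ≫ lmul N z := by
  simp only [lmul, Category.assoc, f.left_act_hom, ← whisker_exchange_assoc,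
    ← leftUnitor_inv_naturality_assoc]

lemma lmul_id (M : Bimod A B) : lmul M (𝟙 A.X) = 𝟙 M.X :=
  lmul_eq (isCentral_id A) (by simp)

lemma rmul_id (M : Bimod A B) : rmul M (𝟙 B.X) = 𝟙 M.X :=
  rmul_eq (isCentral_id B) (by simp)

lemma lmul_comp (M : Bimod A B) {z z' : A.X ⟶ A.X} (h : IsCentral A z)
    (h' : IsCentral A z') : lmul M (z ≫ z') = lmul M z ≫ lmul M z' :=
  lmul_eq (h.comp h') (by
    rw [reassoc_of% actLeft_lmul M h, reassoc_of% lmul_actLeft M h, actLeft_lmul _ h',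
      lmul_actLeft _ h', comp_whiskerRight_assoc])

lemma actRight_lmul (M : Bimod A B) (z : A.X ⟶ A.X) :
    M.actRight ≫ lmul M z = lmul M z ▷ B.X ≫ M.actRight := by
  rw [lmul, leftUnitor_inv_naturality_assoc, whisker_exchange_assoc]
  simp

/-- The two-sided action of central endomorphisms as an endomorphism of bimodules. -/
@[simps]
def mulHom (M : Bimod A B) {z : A.X ⟶ A.X} (hz : IsCentral A z) {z' : B.X ⟶ B.X}
    (hz' : IsCentral B z') : M ⟶ M where
  hom := lmul M z ≫ rmul M z'
  left_act_hom := by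
    rw [reassoc_of% actLeft_lmul M hz, actLeft_rmul, whiskerLeft_comp_assoc]
  right_act_hom := by
    rw [reassoc_of% actRight_lmul, actRight_rmul _ hz', comp_whiskerRight_assoc,
      rmul_actRight _ hz']

lemma rmul_lmul (M : Bimod A B) (z : A.X ⟶ A.X) {z' : B.X ⟶ B.X} (hz' : IsCentral B z') :
    rmul M z' ≫ lmul M z = lmul M z ≫ rmul M z' := by
  let f : M ⟶ M := ⟨rmul M z', actLeft_rmul M z', by
    rw [actRight_rmul _ hz', rmul_actRight _ hz']⟩
  exact (lmul_naturality f z).symm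

/-- A bimodule structure can be checked on a jointly monic family of maps to bimodules. -/
@[simps]
def bimodOfJointlyMono {S : Type*} (M : S → Bimod A B) {X : C} (a : A.X ⊗ X ⟶ X) (b : X ⊗ B.X ⟶ X)
    (f : ∀ s, X ⟶ (M s).X) (ha : ∀ s, a ≫ f s = A.X ◁ f s ≫ (M s).actLeft)
    (hb : ∀ s, b ≫ f s = f s ▷ B.X ≫ (M s).actRight)
    (hf : ∀ {Y : C} {g h : Y ⟶ X}, (∀ s, g ≫ f s = h ≫ f s) → g = h) : Bimod A B where
  X := X
  actLeft := a
  actRight := b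
  one_actLeft := hf fun s => by
    rw [Category.assoc, ha, ← whisker_exchange_assoc, (M s).one_actLeft, leftUnitor_naturality]
  left_assoc := hf fun s => by
    rw [Category.assoc, ha, ← whisker_exchange_assoc, (M s).left_assoc]
    simp only [Category.assoc, ha, ← whiskerLeft_comp_assoc]
    simp
  actRight_one := hf fun s => by
    rw [Category.assoc, hb, whisker_exchange_assoc, (M s).actRight_one, rightUnitor_naturality]
  right_assoc := hf fun s => by
    rw [Category.assoc, hb, whisker_exchange_assoc, (M s).right_assoc]
    simp only [Category.assoc, hb, ← comp_whiskerRight_assoc]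
    simp
  middle_assoc := hf fun s => by
    simp only [Category.assoc, ha, hb, ← comp_whiskerRight_assoc, ← whiskerLeft_comp_assoc]
    simp

/-- Idempotents split in the category of bimodules. -/
lemma exists_bimod_split [IsIdempotentComplete C] (M : Bimod A B) (e : M ⟶ M) (he : e ≫ e = e) :
    ∃ (N : Bimod A B) (i : N ⟶ M) (q : M ⟶ N), i ≫ q = 𝟙 N ∧ q ≫ i = e := by
  obtain ⟨X, i, q, hiq, hqi⟩ :=
    IsIdempotentComplete.idempotents_split M.X e.hom (congrArg (fun k => Bimod.Hom.hom k) he)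
  have hi : i ≫ e.hom = i := by rw [← hqi, reassoc_of% hiq]
  have hq : e.hom ≫ q = q := by rw [← hqi, Category.assoc, hiq, Category.comp_id]
  have ha : (A.X ◁ i ≫ M.actLeft ≫ q) ≫ i = A.X ◁ i ≫ M.actLeft := by
    rw [Category.assoc, Category.assoc, hqi, e.left_act_hom, ← whiskerLeft_comp_assoc, hi]
  have hb : (i ▷ B.X ≫ M.actRight ≫ q) ≫ i = i ▷ B.X ≫ M.actRight := by
    rw [Category.assoc, Category.assoc, hqi, e.right_act_hom, ← comp_whiskerRight_assoc, hi]
  have ha' : A.X ◁ q ≫ A.X ◁ i ≫ M.actLeft ≫ q = M.actLeft ≫ q := by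
    rw [← whiskerLeft_comp_assoc, hqi, ← e.left_act_hom_assoc, hq]
  have hb' : q ▷ B.X ≫ i ▷ B.X ≫ M.actRight ≫ q = M.actRight ≫ q := by
    rw [← comp_whiskerRight_assoc, hqi, ← e.right_act_hom_assoc, hq]
  have : Mono i := mono_of_mono_fac hiq
  let N : Bimod A B := bimodOfJointlyMono (fun _ : Unit => M) _ _ (fun _ => i) (fun _ => ha)
    (fun _ => hb) (fun h => (cancel_mono i).1 (h ()))
  exact ⟨N, ⟨i, ha, hb⟩, ⟨q, ha'.symm, hb'.symm⟩, Bimod.hom_ext _ _ hiq, Bimod.hom_ext _ _ hqi⟩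

section Preadditive

variable [Preadditive C] [MonoidalPreadditive C]

lemma rmul_zero (M : Bimod A B) : rmul M (0 : B.X ⟶ B.X) = 0 := by
  simp [rmul_def]

lemma lmul_zero (M : Bimod A B) : lmul M (0 : A.X ⟶ A.X) = 0 := by
  simp [lmul]

lemma rmul_sum (M : Bimod A B) {S : Type*} [Fintype S] (z : S → (B.X ⟶ B.X)) :
    rmul M (∑ s, z s) = ∑ s, rmul M (z s) :=
  (toRightMod M).mulCentral_sum z

lemma lmul_sum (M : Bimod A B) {S : Type*} [Fintype S] (z : S → (A.X ⟶ A.X)) :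
    lmul M (∑ s, z s) = ∑ s, lmul M (z s) := by
  simp only [lmul, Preadditive.comp_sum, sum_whiskerRight, Preadditive.sum_comp]

instance : (Bimod.forget A (B := B)).Additive where

lemma bimod_sum_hom {M N : Bimod A B} {S : Type*} [Fintype S] (f : S → (M ⟶ N)) :
    Bimod.Hom.hom (∑ s, f s : M ⟶ N) = ∑ s, (f s).hom :=
  (Bimod.forget A (B := B)).map_sum f Finset.univ

/-- Finite families of bimodules have direct sums. -/
lemma exists_bimod_directSum [HasFiniteBiproducts C] {S : Type} [Fintype S] (M : S → Bimod A B) :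
    ∃ (N : Bimod A B) (i : ∀ s, M s ⟶ N) (q : ∀ s, N ⟶ M s),
      (∀ s, i s ≫ q s = 𝟙 _) ∧ ∑ s, q s ≫ i s = 𝟙 N := by
  classical
  let X : C := ⨁ fun s => (M s).X
  let i : ∀ s, (M s).X ⟶ X := biproduct.ι fun s => (M s).X
  let q : ∀ s, X ⟶ (M s).X := biproduct.π fun s => (M s).X
  let a : A.X ⊗ X ⟶ X := ∑ s, A.X ◁ q s ≫ (M s).actLeft ≫ i s
  let b : X ⊗ B.X ⟶ X := ∑ s, q s ▷ B.X ≫ (M s).actRight ≫ i s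
  have hiq : ∀ s, i s ≫ q s = 𝟙 _ := fun s => biproduct.ι_π_self _ s
  have hne : ∀ {s t}, s ≠ t → i s ≫ q t = 0 := fun h => biproduct.ι_π_ne _ h
  have haq : ∀ s, a ≫ q s = A.X ◁ q s ≫ (M s).actLeft := fun s => by
    rw [Preadditive.sum_comp, Finset.sum_eq_single s]
    · rw [Category.assoc, Category.assoc, hiq, Category.comp_id]
    · intro t _ ht
      rw [Category.assoc, Category.assoc, hne ht, comp_zero, comp_zero]
    · simp
  have hbq : ∀ s, b ≫ q s = q s ▷ B.X ≫ (M s).actRight := fun s => by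
    rw [Preadditive.sum_comp, Finset.sum_eq_single s]
    · rw [Category.assoc, Category.assoc, hiq, Category.comp_id]
    · intro t _ ht
      rw [Category.assoc, Category.assoc, hne ht, comp_zero, comp_zero]
    · simp
  have hia : ∀ s, A.X ◁ i s ≫ a = (M s).actLeft ≫ i s := fun s => by
    rw [Preadditive.comp_sum, Finset.sum_eq_single s]
    · rw [← whiskerLeft_comp_assoc, hiq, whiskerLeft_id, Category.id_comp]
    · intro t _ ht
      rw [← whiskerLeft_comp_assoc, hne ht.symm, MonoidalPreadditive.whiskerLeft_zero, zero_comp]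
    · simp
  have hib : ∀ s, i s ▷ B.X ≫ b = (M s).actRight ≫ i s := fun s => by
    rw [Preadditive.comp_sum, Finset.sum_eq_single s]
    · rw [← comp_whiskerRight_assoc, hiq, id_whiskerRight, Category.id_comp]
    · intro t _ ht
      rw [← comp_whiskerRight_assoc, hne ht.symm, MonoidalPreadditive.zero_whiskerRight, zero_comp]
    · simp
  let N : Bimod A B := bimodOfJointlyMono M a b q haq hbq (fun h => biproduct.hom_ext _ _ h)
  exact ⟨N, fun s => ⟨i s, (hia s).symm, (hib s).symm⟩, fun s => ⟨q s, haq s, hbq s⟩,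
    fun s => Bimod.hom_ext _ _ (hiq s), Bimod.hom_ext _ _ ((bimod_sum_hom _).trans biproduct.total)⟩

end Preadditive

end BimodBasic

section Restrict

variable {C : Type u} [Category.{v} C] [MonoidalCategory C] {A A' B B' : Mon C}

instance (f : A ⟶ A') (g : B ⟶ B') : (restrict f g).Faithful where
  map_injective h := Bimod.hom_ext _ _ (congrArg (fun k => Bimod.Hom.hom k) h :)

instance [Preadditive C] [MonoidalPreadditive C] (f : A ⟶ A') (g : B ⟶ B') :
    (restrict f g).Additive where

instance [Preadditive C] [MonoidalPreadditive C] (𝕜 : Type w) [Field 𝕜] [Linear 𝕜 C]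
    [MonoidalLinear 𝕜 C] (f : A ⟶ A') (g : B ⟶ B') : (restrict f g).Linear 𝕜 where

lemma restrict_full (f : A ⟶ A') (g : B ⟶ B') (i : A'.X ⟶ A.X) (j : B'.X ⟶ B.X)
    (hi : i ≫ f.hom = 𝟙 _) (hj : j ≫ g.hom = 𝟙 _) : (restrict f g).Full where
  map_surjective {M N} k := by
    let k' : M.X ⟶ N.X := k.hom
    have hl : (f.hom ▷ M.X ≫ M.actLeft) ≫ k' = A.X ◁ k' ≫ f.hom ▷ N.X ≫ N.actLeft :=
      k.left_act_hom
    have hr : (M.X ◁ g.hom ≫ M.actRight) ≫ k' = k' ▷ B.X ≫ N.X ◁ g.hom ≫ N.actRight :=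
      k.right_act_hom
    refine ⟨⟨k', ?_, ?_⟩, rfl⟩
    · have := congrArg (fun t => i ▷ M.X ≫ t) hl
      simpa only [Category.assoc, whisker_exchange_assoc, ← comp_whiskerRight_assoc, hi,
        id_whiskerRight, Category.id_comp] using this
    · have := congrArg (fun t => M.X ◁ j ≫ t) hr
      simpa only [Category.assoc, ← whisker_exchange_assoc, ← whiskerLeft_comp_assoc, hj,
        whiskerLeft_id, Category.id_comp] using this

end Restrict

section Regular

variable {C : Type u} [Category.{v} C] [MonoidalCategory C] {L : Mon C}

lemma lmul_regular {z : L.X ⟶ L.X} (h : IsCentral L z) : lmul (Bimod.regular L) z = z :=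
  lmul_eq h h.right.symm

lemma rmul_regular {z : L.X ⟶ L.X} (h : IsCentral L z) : rmul (Bimod.regular L) z = z :=
  rmul_eq h h.left.symm

end Regular

section BimodBlocks

variable {C : Type u} [Category.{v} C] [Abelian C] [MonoidalCategory C]
  {L : Mon C} {S : Type} [Fintype S] {L' : S → Mon C} (T : ProductDecomposition L L')

namespace ProductDecomposition

/-- An `L`-bimodule on which the idempotents of two factors of `L` act as the identity is a
bimodule over these factors. -/
lemma exists_restrict_iso (s t : S) (M : Bimod L L) (hl : lmul M (T.e s) = 𝟙 M.X)
    (hr : rmul M (T.e t) = 𝟙 M.X) :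
    ∃ N : Bimod (L' s) (L' t), Nonempty ((restrict (T.p s) (T.p t)).obj N ≅ M) := by
  have ha : T.e s ▷ M.X ≫ M.actLeft = M.actLeft := by
    rw [← lmul_actLeft _ (T.e_central s), hl, whiskerLeft_id, Category.id_comp]
  have hb : M.X ◁ T.e t ≫ M.actRight = M.actRight := by
    rw [← actRight_rmul _ (T.e_central t), hr, Category.comp_id]
  let N : Bimod (L' s) (L' t) :=
    { X := M.X
      actLeft := T.i s ▷ M.X ≫ M.actLeft
      one_actLeft := by
        rw [← comp_whiskerRight_assoc, T.one_i, comp_whiskerRight_assoc, ha, M.one_actLeft]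
      left_assoc := by
        rw [← comp_whiskerRight_assoc, T.mul_i, comp_whiskerRight_assoc, M.left_assoc,
          MonoidalCategory.tensorHom_def']
        simp [whisker_exchange_assoc]
      actRight := M.X ◁ T.i t ≫ M.actRight
      actRight_one := by
        rw [← whiskerLeft_comp_assoc, T.one_i, whiskerLeft_comp_assoc, hb, M.actRight_one]
      right_assoc := by
        rw [← whiskerLeft_comp_assoc, T.mul_i, whiskerLeft_comp_assoc, M.right_assoc,
          MonoidalCategory.tensorHom_def]
        simp [← whisker_exchange_assoc]
      middle_assoc := by
        rw [comp_whiskerRight_assoc, ← whisker_exchange_assoc, M.middle_assoc,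
          associator_naturality_right_assoc, associator_naturality_left_assoc,
          ← whiskerLeft_comp_assoc, ← whisker_exchange_assoc] }
  refine ⟨N, ⟨Bimod.isoOfIso (Iso.refl M.X) ?_ ?_⟩⟩
  · change ((T.p s).hom ▷ M.X ≫ T.i s ▷ M.X ≫ M.actLeft) ≫ 𝟙 M.X = L.X ◁ 𝟙 M.X ≫ M.actLeft
    rw [← comp_whiskerRight_assoc]
    simpa [ProductDecomposition.e] using ha
  · change (M.X ◁ (T.p t).hom ≫ M.X ◁ T.i t ≫ M.actRight) ≫ 𝟙 M.X = 𝟙 M.X ▷ L.X ≫ M.actRight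
    rw [← whiskerLeft_comp_assoc]
    simpa [ProductDecomposition.e] using hb

/-- The idempotent endomorphism of an `L`-bimodule corresponding to a pair of factors of `L`. -/
def bimodE (st : S × S) (M : Bimod L L) : M ⟶ M :=
  mulHom M (T.e_central st.1) (T.e_central st.2)

lemma bimodE_hom (st : S × S) (M : Bimod L L) :
    (T.bimodE st M).hom = lmul M (T.e st.1) ≫ rmul M (T.e st.2) := rfl

lemma bimodE_naturality (st : S × S) {M N : Bimod L L} (f : M ⟶ N) :
    T.bimodE st M ≫ f = f ≫ T.bimodE st N :=
  Bimod.hom_ext _ _ (by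
    rw [bimod_comp_hom, bimod_comp_hom, bimodE_hom, bimodE_hom, Category.assoc, rmul_naturality,
      reassoc_of% lmul_naturality])

lemma bimodE_comp_hom (st st' : S × S) (M : Bimod L L) :
    (T.bimodE st M ≫ T.bimodE st' M).hom =
      lmul M (T.e st.1 ≫ T.e st'.1) ≫ rmul M (T.e st.2 ≫ T.e st'.2) := by
  rw [bimod_comp_hom, bimodE_hom, bimodE_hom, lmul_comp _ (T.e_central _) (T.e_central _),
    rmul_comp _ (T.e_central _) (T.e_central _), Category.assoc, Category.assoc,
    reassoc_of% rmul_lmul M (T.e st'.1) (T.e_central st.2)]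

lemma lmul_e_e (s : S) (M : Bimod L L) : lmul M (T.e s) ≫ lmul M (T.e s) = lmul M (T.e s) := by
  rw [← lmul_comp _ (T.e_central _) (T.e_central _), T.e_e]

lemma exists_bimod_component (st : S × S) (M : Bimod L L) :
    ∃ (N : Bimod (L' st.1) (L' st.2)) (i : (restrict (T.p st.1) (T.p st.2)).obj N ⟶ M)
      (q : M ⟶ (restrict (T.p st.1) (T.p st.2)).obj N), i ≫ q = 𝟙 _ ∧ q ≫ i = T.bimodE st M := by
  obtain ⟨K, i, q, hiq, hqi⟩ := exists_bimod_split M (T.bimodE st M)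
    (Bimod.hom_ext _ _ (by rw [bimodE_comp_hom, T.e_e, T.e_e, bimodE_hom]))
  have h : T.bimodE st K = 𝟙 K := by
    rw [← Category.comp_id (T.bimodE st K), ← hiq, ← Category.assoc, bimodE_naturality, ← hqi,
      Category.assoc, Category.assoc, hiq, Category.comp_id, hiq]
  have h' : lmul K (T.e st.1) ≫ rmul K (T.e st.2) = 𝟙 K.X :=
    congrArg (fun k => Bimod.Hom.hom k) h
  have hl : lmul K (T.e st.1) = 𝟙 K.X := by
    rw [← h', ← T.lmul_e_e, Category.assoc, h', T.lmul_e_e, Category.comp_id]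
  have hr : rmul K (T.e st.2) = 𝟙 K.X := by rwa [hl, Category.id_comp] at h'
  obtain ⟨N, ⟨f⟩⟩ := T.exists_restrict_iso st.1 st.2 K hl hr
  refine ⟨N, f.hom ≫ i, q ≫ f.inv, ?_, ?_⟩
  · rw [Category.assoc, reassoc_of% hiq, f.hom_inv_id]
  · rw [Category.assoc, f.inv_hom_id_assoc, hqi]

lemma bimodE_regular (st : S × S) :
    (T.bimodE st (Bimod.regular L)).hom = T.e st.1 ≫ T.e st.2 := by
  rw [bimodE_hom, lmul_regular (T.e_central _), rmul_regular (T.e_central _)]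
  rfl

lemma p_mul_i_left (s : S) : ((T.p s).hom ▷ (L' s).X ≫ μ[(L' s).X]) ≫ T.i s =
    L.X ◁ T.i s ≫ μ[L.X] := by
  rw [Category.assoc, T.mul_i, MonoidalCategory.tensorHom_def, Category.assoc,
    ← comp_whiskerRight_assoc, ← whisker_exchange_assoc]
  change _ ≫ T.e s ▷ L.X ≫ _ = _
  rw [(T.e_central s).right, ← (T.e_central s).left, ← whiskerLeft_comp_assoc, T.i_e]

lemma p_mul_i_right (s : S) : ((L' s).X ◁ (T.p s).hom ≫ μ[(L' s).X]) ≫ T.i s =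
    T.i s ▷ L.X ≫ μ[L.X] := by
  rw [Category.assoc, T.mul_i, MonoidalCategory.tensorHom_def', Category.assoc,
    ← whiskerLeft_comp_assoc, whisker_exchange_assoc]
  change _ ≫ L.X ◁ T.e s ≫ _ = _
  rw [(T.e_central s).left, ← (T.e_central s).right, ← comp_whiskerRight_assoc, T.i_e]

variable [MonoidalPreadditive C]

/-- The block decomposition of the category of bimodules over a product of algebras. -/
noncomputable def bimodBlocks :
    BlockDecomposition fun st : S × S => restrict (T.p st.1) (T.p st.2) where
  E := T.bimodE
  natural st _ _ f := T.bimodE_naturality st f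
  sum_E M := Bimod.hom_ext _ _ (by
    rw [bimod_sum_hom]
    simp only [bimodE_hom]
    rw [Fintype.sum_prod_type]
    simp only [← Preadditive.comp_sum, ← Preadditive.sum_comp]
    rw [← lmul_sum, ← rmul_sum, T.sum_e, lmul_id, rmul_id, Category.comp_id, Bimod.id_hom'])
  orthogonal {st st'} h M := Bimod.hom_ext _ _ (by
    rw [bimodE_comp_hom, bimod_zero_hom]
    by_cases h₁ : st.1 = st'.1
    · rw [T.e_e_of_ne fun h₂ => h (Prod.ext h₁ h₂), rmul_zero, comp_zero]
    · rw [T.e_e_of_ne h₁, lmul_zero, zero_comp])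
  E_obj st X := Bimod.hom_ext _ _ (by
    have hl : lmul ((restrict (T.p st.1) (T.p st.2)).obj X) (T.e st.1) = 𝟙 X.X :=
      lmul_eq (T.e_central _) (by
        change ((T.p st.1).hom ▷ X.X ≫ X.actLeft) ≫ 𝟙 X.X =
          T.e st.1 ▷ X.X ≫ (T.p st.1).hom ▷ X.X ≫ X.actLeft
        rw [← comp_whiskerRight_assoc, T.e_p, Category.comp_id])
    have hr : rmul ((restrict (T.p st.1) (T.p st.2)).obj X) (T.e st.2) = 𝟙 X.X :=
      rmul_eq (T.e_central _) (by
        change (X.X ◁ (T.p st.2).hom ≫ X.actRight) ≫ 𝟙 X.X =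
          X.X ◁ T.e st.2 ≫ X.X ◁ (T.p st.2).hom ≫ X.actRight
        rw [← whiskerLeft_comp_assoc, T.e_p, Category.comp_id])
    rw [bimodE_hom, hl, hr]
    exact Category.comp_id _)
  obj st M := (T.exists_bimod_component st M).choose
  inj st M := (T.exists_bimod_component st M).choose_spec.choose
  proj st M := (T.exists_bimod_component st M).choose_spec.choose_spec.choose
  inj_proj st M := (T.exists_bimod_component st M).choose_spec.choose_spec.choose_spec.1
  proj_inj st M := (T.exists_bimod_component st M).choose_spec.choose_spec.choose_spec.2
  exists_sum X :=
    have : HasFiniteBiproducts C := Abelian.hasFiniteBiproducts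
    exists_bimod_directSum fun st => (restrict (T.p st.1) (T.p st.2)).obj (X st)

instance (s t : S) : (restrict (T.p s) (T.p t)).Full :=
  restrict_full _ _ (T.i s) (T.i t) (T.i_p s) (T.i_p t)

/-- The inclusion of a factor is a morphism of `L`-bimodules. -/
def regularInj (s : S) :
    (restrict (T.p s) (T.p s)).obj (Bimod.regular (L' s)) ⟶ Bimod.regular L where
  hom := T.i s
  left_act_hom := T.p_mul_i_left s
  right_act_hom := T.p_mul_i_right s

/-- The projection to a factor is a morphism of `L`-bimodules. -/
def regularProj (s : S) :
    Bimod.regular L ⟶ (restrict (T.p s) (T.p s)).obj (Bimod.regular (L' s)) where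
  hom := (T.p s).hom
  left_act_hom := by
    change μ[L.X] ≫ (T.p s).hom = L.X ◁ (T.p s).hom ≫ (T.p s).hom ▷ (L' s).X ≫ μ[(L' s).X]
    rw [IsMonHom.mul_hom, MonoidalCategory.tensorHom_def', Category.assoc]
  right_act_hom := by
    change μ[L.X] ≫ (T.p s).hom = (T.p s).hom ▷ L.X ≫ (L' s).X ◁ (T.p s).hom ≫ μ[(L' s).X]
    rw [IsMonHom.mul_hom, MonoidalCategory.tensorHom_def, Category.assoc]

/-- The diagonal components of the regular bimodule. -/
noncomputable def regularComponentIso (s : S) :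
    T.bimodBlocks.obj (s, s) (Bimod.regular L) ≅ Bimod.regular (L' s) :=
  T.bimodBlocks.objIso (T.regularInj s) (T.regularProj s) (Bimod.hom_ext _ _ (T.i_p s))
    (Bimod.hom_ext _ _ (((T.bimodE_regular (s, s)).trans (T.e_e s)).symm))

/-- The off-diagonal components of the regular bimodule vanish. -/
lemma isZero_regular_component {s t : S} (h : s ≠ t) :
    IsZero (T.bimodBlocks.obj (s, t) (Bimod.regular L)) :=
  (IsZero.iff_id_eq_zero _).2 ((restrict (T.p s) (T.p t)).map_injective (by
    have h₀ := T.bimodBlocks.id_map_obj_eq_zero (s := (s, t)) (M := Bimod.regular L)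
      (Bimod.hom_ext _ _ ((T.bimodE_regular (s, t)).trans (T.e_e_of_ne h)))
    rw [CategoryTheory.Functor.map_id, CategoryTheory.Functor.map_zero]
    exact h₀))

end ProductDecomposition

end BimodBlocks

section TensorBimod

variable {C : Type u} [Category.{v} C] [Abelian C] [MonoidalCategory C] [RigidCategory C]

/-- The tensor product of bimodules over `L` agrees with the tensor product over `K`, for bimodules
restricted along an algebra morphism `L ⟶ K` with a section in `C`. -/
lemma exists_restrict_tensorBimod_iso {L K A A' B B' : Mon C} (p : L ⟶ K) (i : K.X ⟶ L.X)
    (hi : i ≫ p.hom = 𝟙 _) (f : A ⟶ A') (g : B ⟶ B') (M : Bimod A' K) (N : Bimod K B') :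
    ∃ φ : (restrictObj f p M).tensorBimod (restrictObj p g N) ≅
        restrictObj f g (M.tensorBimod N),
      coequalizer.π ((restrictObj f p M).actRight ▷ N.X)
          ((α_ M.X L.X N.X).hom ≫ M.X ◁ (restrictObj p g N).actLeft) ≫ φ.hom.hom =
        coequalizer.π (M.actRight ▷ N.X) ((α_ M.X K.X N.X).hom ≫ M.X ◁ N.actLeft) := by
  let a : (M.X ⊗ K.X) ⊗ N.X ⟶ M.X ⊗ N.X := M.actRight ▷ N.X
  let b : (M.X ⊗ K.X) ⊗ N.X ⟶ M.X ⊗ N.X := (α_ M.X K.X N.X).hom ≫ M.X ◁ N.actLeft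
  let a' : (M.X ⊗ L.X) ⊗ N.X ⟶ M.X ⊗ N.X := (M.X ◁ p.hom ≫ M.actRight) ▷ N.X
  let b' : (M.X ⊗ L.X) ⊗ N.X ⟶ M.X ⊗ N.X :=
    (α_ M.X L.X N.X).hom ≫ M.X ◁ (p.hom ▷ N.X ≫ N.actLeft)
  have ha : a' = (M.X ◁ p.hom) ▷ N.X ≫ a := comp_whiskerRight _ _ _
  have hb : b' = (M.X ◁ p.hom) ▷ N.X ≫ b := by simp [b', b]
  have ha' : a = (M.X ◁ i) ▷ N.X ≫ a' := by
    rw [ha, ← comp_whiskerRight_assoc, ← whiskerLeft_comp, hi]; simp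
  have hb' : b = (M.X ◁ i) ▷ N.X ≫ b' := by
    rw [hb, ← comp_whiskerRight_assoc, ← whiskerLeft_comp, hi]; simp
  let e : coequalizer a' b' ≅ coequalizer a b :=
    { hom := coequalizer.desc (coequalizer.π a b) (by
        rw [ha, hb, Category.assoc, Category.assoc, coequalizer.condition])
      inv := coequalizer.desc (coequalizer.π a' b') (by
        rw [ha', hb', Category.assoc, Category.assoc, coequalizer.condition])
      hom_inv_id := by ext; simp
      inv_hom_id := by ext; simp }
  have he : coequalizer.π a' b' ≫ e.hom = coequalizer.π a b := coequalizer.π_desc _ _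
  let l : A'.X ⊗ coequalizer a b ⟶ coequalizer a b := Bimod.TensorBimod.actLeft M N
  let r : coequalizer a b ⊗ B'.X ⟶ coequalizer a b := Bimod.TensorBimod.actRight M N
  have hl : A'.X ◁ coequalizer.π a b ≫ l =
      (α_ A'.X M.X N.X).inv ≫ M.actLeft ▷ N.X ≫ coequalizer.π a b :=
    Bimod.TensorBimod.whiskerLeft_π_actLeft M N
  have hr : coequalizer.π a b ▷ B'.X ≫ r =
      (α_ M.X N.X B'.X).hom ≫ M.X ◁ N.actRight ≫ coequalizer.π a b :=
    Bimod.TensorBimod.π_tensor_id_actRight M N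
  let l' : A.X ⊗ coequalizer a' b' ⟶ coequalizer a' b' :=
    Bimod.TensorBimod.actLeft (restrictObj f p M) (restrictObj p g N)
  let r' : coequalizer a' b' ⊗ B.X ⟶ coequalizer a' b' :=
    Bimod.TensorBimod.actRight (restrictObj f p M) (restrictObj p g N)
  have hl' : A.X ◁ coequalizer.π a' b' ≫ l' =
        (α_ A.X M.X N.X).inv ≫ (f.hom ▷ M.X ≫ M.actLeft) ▷ N.X ≫ coequalizer.π a' b' :=
    Bimod.TensorBimod.whiskerLeft_π_actLeft (restrictObj f p M) (restrictObj p g N)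
  have hr' : coequalizer.π a' b' ▷ B.X ≫ r' =
        (α_ M.X N.X B.X).hom ≫ M.X ◁ (N.X ◁ g.hom ≫ N.actRight) ≫ coequalizer.π a' b' :=
    Bimod.TensorBimod.π_tensor_id_actRight (restrictObj f p M) (restrictObj p g N)
  refine ⟨Bimod.isoOfIso e ?_ ?_, he⟩
  · refine (cancel_epi ((tensorLeft A.X).map (coequalizer.π a' b'))).1 ?_
    change A.X ◁ coequalizer.π a' b' ≫ l' ≫ e.hom =
      A.X ◁ coequalizer.π a' b' ≫ A.X ◁ e.hom ≫ f.hom ▷ (coequalizer a b) ≫ l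
    rw [reassoc_of% hl', he, ← whiskerLeft_comp_assoc, he, whisker_exchange_assoc, hl]
    simp
  · refine (cancel_epi ((tensorRight B.X).map (coequalizer.π a' b'))).1 ?_
    change coequalizer.π a' b' ▷ B.X ≫ r' ≫ e.hom =
      coequalizer.π a' b' ▷ B.X ≫ e.hom ▷ B.X ≫ (coequalizer a b) ◁ g.hom ≫ r
    rw [reassoc_of% hr', he, ← comp_whiskerRight_assoc, he, ← whisker_exchange_assoc, hr]
    simp

lemma isZero_tensorBimod {L A B : Mon C} [MonoidalPreadditive C] (M : Bimod A L) (N : Bimod L B)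
    {z : L.X ⟶ L.X} (hM : M.X ◁ z ≫ M.actRight = M.actRight) (hN : z ▷ N.X ≫ N.actLeft = 0) :
    IsZero (M.tensorBimod N) := by
  let π : M.X ⊗ N.X ⟶ (M.tensorBimod N).X :=
    coequalizer.π (M.actRight ▷ N.X) ((α_ M.X L.X N.X).hom ≫ M.X ◁ N.actLeft)
  have : Epi π := inferInstanceAs (Epi (coequalizer.π _ _))
  have hc : M.actRight ▷ N.X ≫ π = (α_ M.X L.X N.X).hom ≫ M.X ◁ N.actLeft ≫ π :=
    (coequalizer.condition _ _).trans (Category.assoc _ _ _)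
  have h₁ : M.actRight ▷ N.X ≫ π = 0 := by
    rw [← hM, comp_whiskerRight, Category.assoc, hc, associator_naturality_middle_assoc,
      ← whiskerLeft_comp_assoc, hN]
    simp
  have h₂ : π = 0 := by
    have h := congrArg (fun t => (ρ_ M.X).inv ▷ N.X ≫ (M.X ◁ η[L.X]) ▷ N.X ≫ t) h₁
    simp only [← comp_whiskerRight_assoc, M.actRight_one, Iso.inv_hom_id, id_whiskerRight,
      Category.id_comp, comp_zero] at h
    exact h
  refine (IsZero.iff_id_eq_zero _).2 (Bimod.hom_ext _ _ ((cancel_epi π).1 ?_))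
  change π ≫ 𝟙 _ = π ≫ 0
  rw [h₂, zero_comp, zero_comp]

end TensorBimod

/-- The multitensor category of bimodules over a product of algebras decomposes. -/
theorem ProductDecomposition.isBimodDecomposition (𝕜 : Type w) [Field 𝕜] {C : Type u}
    [Category.{v} C] [Abelian C] [Linear 𝕜 C] [MonoidalCategory C] [RigidCategory C]
    [MonoidalPreadditive C] [MonoidalLinear 𝕜 C] {L : Mon C} {n : ℕ} {L' : Fin n → Mon C}
    (T : ProductDecomposition L L') :
    IsBimodDecomposition 𝕜 T.p T.bimodBlocks.equivalence where
  additive := T.bimodBlocks.functor_additive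
  linear := T.bimodBlocks.functor_linear 𝕜
  directSum := ⟨T.bimodBlocks.incl, fun M => ⟨T.bimodBlocks.isColimitCofan M⟩⟩
  tensor i j k M N := exists_restrict_tensorBimod_iso (T.p j) (T.i j) (T.i_p j) (T.p i) (T.p k) M N
  tensor_zero i j k l M N h :=
    isZero_tensorBimod (z := T.e j) _ _
      (by
        change M.X ◁ T.e j ≫ M.X ◁ (T.p j).hom ≫ M.actRight = M.X ◁ (T.p j).hom ≫ M.actRight
        rw [← whiskerLeft_comp_assoc, T.e_p])
      (by
        change T.e j ▷ N.X ≫ (T.p k).hom ▷ N.X ≫ N.actLeft = 0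
        rw [← comp_whiskerRight_assoc, ProductDecomposition.e, Category.assoc, T.i_p_of_ne h]
        simp)
  unit_diag i := ⟨T.regularComponentIso i⟩
  unit_offDiag _ _ h := T.isZero_regular_component h

/-! ### Primitive idempotents -/

section Primitive

/-- A finite set of nonzero orthogonal idempotents of a ring with sum `1`. -/
structure IsCompleteOrthogonal {R : Type*} [Ring R] (s : Finset R) : Prop where
  mul_self : ∀ e ∈ s, e * e = e
  ne_zero : ∀ e ∈ s, e ≠ 0
  orthogonal : ∀ e ∈ s, ∀ f ∈ s, e ≠ f → e * f = 0
  sum_eq : ∑ e ∈ s, e = 1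

lemma IsCompleteOrthogonal.card_le (𝕜 : Type*) [Field 𝕜] {R : Type*} [Ring R] [Algebra 𝕜 R]
    [Module.Finite 𝕜 R] {s : Finset R} (hs : IsCompleteOrthogonal s) :
    s.card ≤ Module.finrank 𝕜 R := by
  refine LinearIndependent.finset_card_le_finrank ?_
  rw [linearIndependent_iff']
  intro t g h e he
  have h' := congrArg (fun x => x * (e : R)) h
  simp only [Finset.sum_mul, zero_mul] at h'
  rw [Finset.sum_eq_single e] at h'
  · rw [smul_mul_assoc, hs.mul_self _ e.2] at h'
    exact (smul_eq_zero.1 h').resolve_right (hs.ne_zero _ e.2)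
  · intro f _ hf
    rw [smul_mul_assoc, hs.orthogonal _ f.2 _ e.2 (fun h => hf (Subtype.ext h)), smul_zero]
  · exact fun h => absurd he h

/-- A finite-dimensional algebra has a complete set of orthogonal primitive idempotents. -/
lemma exists_primitive (𝕜 : Type*) [Field 𝕜] (R : Type*) [Ring R] [Algebra 𝕜 R]
    [Module.Finite 𝕜 R] : ∃ s : Finset R, IsCompleteOrthogonal s ∧
      ∀ e ∈ s, ∀ f : R, f * f = f → e * f = f → f * e = f → f = 0 ∨ f = e := by
  classical
  have h₀ : ∃ s : Finset R, IsCompleteOrthogonal s := by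
    by_cases h : (1 : R) = 0
    · exact ⟨∅, by simp, by simp, by simp, by simp [h]⟩
    · exact ⟨{1}, by simp, by simp [h], by simp, by simp⟩
  obtain ⟨s, hs, hmax⟩ : ∃ s : Finset R, IsCompleteOrthogonal s ∧
      ∀ t : Finset R, IsCompleteOrthogonal t → t.card ≤ s.card := by
    have hfin : {n | ∃ s : Finset R, IsCompleteOrthogonal s ∧ s.card = n}.Finite :=
      (Set.finite_Iic (Module.finrank 𝕜 R)).subset (by
        rintro _ ⟨s, hs, rfl⟩
        exact hs.card_le 𝕜)
    obtain ⟨s₀, hs₀⟩ := h₀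
    obtain ⟨_, ⟨s, hs, rfl⟩, hm⟩ :=
      Set.exists_max_image _ id hfin ⟨_, s₀, hs₀, rfl⟩
    exact ⟨s, hs, fun t ht => hm _ ⟨t, ht, rfl⟩⟩
  refine ⟨s, hs, fun e he f hf hef hfe => ?_⟩
  by_contra! hcon
  obtain ⟨hf0, hfe'⟩ := hcon
  have hg0 : e - f ≠ 0 := sub_ne_zero.2 hfe'.symm
  have hee := hs.mul_self e he
  have hgg : (e - f) * (e - f) = e - f := by rw [sub_mul, mul_sub, mul_sub, hee, hef, hfe, hf]; abel
  have hfg : f * (e - f) = 0 := by rw [mul_sub, hfe, hf, sub_self]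
  have hgf : (e - f) * f = 0 := by rw [sub_mul, hef, hf, sub_self]
  have heg : e * (e - f) = e - f := by rw [mul_sub, hee, hef]
  have hge : (e - f) * e = e - f := by rw [sub_mul, hee, hfe]
  have hl : ∀ x ∈ s.erase e, ∀ y, e * y = y → x * y = 0 := fun x hx y hy => by
    rw [← hy, ← mul_assoc, hs.orthogonal x (Finset.mem_of_mem_erase hx) e he
      (Finset.ne_of_mem_erase hx), zero_mul]
  have hr : ∀ x ∈ s.erase e, ∀ y, y * e = y → y * x = 0 := fun x hx y hy => by
    rw [← hy, mul_assoc, hs.orthogonal e he x (Finset.mem_of_mem_erase hx)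
      (Finset.ne_of_mem_erase hx).symm, mul_zero]
  have hnot : ∀ y, y ≠ 0 → y * y = y → e * y = y → y ∉ s.erase e := fun y hy hyy hey hmem =>
    hy (hyy.symm.trans (hl y hmem y hey))
  have hfn : f ∉ insert (e - f) (s.erase e) := by
    rw [Finset.mem_insert, not_or]
    refine ⟨fun h => hf0 ?_, hnot f hf0 hf hef⟩
    rw [← hfg, ← h, hf]
  have hgn := hnot _ hg0 hgg heg
  have ht : IsCompleteOrthogonal (insert f (insert (e - f) (s.erase e))) := by
    refine ⟨?_, ?_, ?_, ?_⟩
    · simp only [Finset.forall_mem_insert]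
      exact ⟨hf, hgg, fun x hx => hs.mul_self x (Finset.mem_of_mem_erase hx)⟩
    · simp only [Finset.forall_mem_insert]
      exact ⟨hf0, hg0, fun x hx => hs.ne_zero x (Finset.mem_of_mem_erase hx)⟩
    · simp only [Finset.forall_mem_insert]
      exact ⟨⟨fun h => absurd rfl h, fun _ => hfg, fun x hx _ => hr x hx f hfe⟩,
        ⟨fun _ => hgf, fun h => absurd rfl h, fun x hx _ => hr x hx _ hge⟩,
        fun x hx => ⟨fun _ => hl x hx f hef, fun _ => hl x hx _ heg, fun y hy h =>
          hs.orthogonal x (Finset.mem_of_mem_erase hx) y (Finset.mem_of_mem_erase hy) h⟩⟩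
    · rw [Finset.sum_insert hfn, Finset.sum_insert hgn, ← add_assoc, add_sub_cancel,
        Finset.add_sum_erase s (fun x => x) he, hs.sum_eq]
  have := hmax _ ht
  rw [Finset.card_insert_of_notMem hfn, Finset.card_insert_of_notMem hgn,
    Finset.card_erase_of_mem he] at this
  have := Finset.card_pos.2 ⟨e, he⟩
  omega

end Primitive

section FiniteHom

open scoped ModuleCat

/-- Morphism spaces of a finite linear category are finite-dimensional. -/
lemma IsFiniteLinear.finite_hom {𝕜 : Type w} [Field 𝕜] {M : Type u₁} [Category.{v₁} M]
    [Preadditive M] [Linear 𝕜 M] (h : IsFiniteLinear 𝕜 M) (X Y : M) :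
    Module.Finite 𝕜 (X ⟶ Y) := by
  obtain ⟨A, _, _, _, e, _, _⟩ := h
  have h₁ : ∀ V : FGModuleCat.{w} A, Module.Finite 𝕜 V.obj := fun V =>
    have : Module.Finite A V.obj := inferInstanceAs (Module.Finite A V)
    Module.Finite.trans A V.obj
  let φ : (e.functor.obj X ⟶ e.functor.obj Y) →ₗ[𝕜]
      ((e.functor.obj X).obj →ₗ[𝕜] (e.functor.obj Y).obj) :=
    { toFun := fun f => f.hom.hom.restrictScalars 𝕜
      map_add' := fun _ _ => rfl
      map_smul' := fun _ _ => rfl }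
  have hφ : Function.Injective φ := fun f g h => FGModuleCat.hom_ext
    (LinearMap.restrictScalars_injective 𝕜 h)
  have := h₁ (e.functor.obj X)
  have := h₁ (e.functor.obj Y)
  exact Module.Finite.of_injective (φ ∘ₗ e.functor.mapLinearMap 𝕜)
    (hφ.comp e.functor.map_injective)

end FiniteHom

section Split

variable {C : Type u} [Category.{v} C] [MonoidalCategory C]

/-- The image of a central idempotent of an algebra, as an algebra. -/
@[simps]
def splitAlgebra {L : Mon C} {X : C} (i : X ⟶ L.X) (q : L.X ⟶ X) (hiq : i ≫ q = 𝟙 X)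
    (h : IsCentral L (q ≫ i)) : Mon C where
  X := X
  mon :=
    have hm : (i ⊗ₘ i) ≫ μ[L.X] ≫ q ≫ i = (i ⊗ₘ i) ≫ μ[L.X] := by
      rw [← h.left, MonoidalCategory.tensorHom_def, Category.assoc, ← whiskerLeft_comp_assoc,
        reassoc_of% hiq, Category.assoc]
    have hi : i ≫ q ≫ i = i := by rw [reassoc_of% hiq]
    have : Mono i := mono_of_mono_fac hiq
    { one := η[L.X] ≫ q
      mul := (i ⊗ₘ i) ≫ μ[L.X] ≫ q
      one_mul := by
        have h₁ : (η[L.X] ≫ q ≫ i) ▷ L.X ≫ μ[L.X] = (λ_ L.X).hom ≫ q ≫ i := by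
          rw [← Iso.inv_comp_eq, h.one_right]
        rw [← cancel_mono i, Category.assoc, Category.assoc, Category.assoc, hm,
          MonoidalCategory.tensorHom_def, Category.assoc, ← comp_whiskerRight_assoc,
          Category.assoc, ← whisker_exchange_assoc, h₁, leftUnitor_naturality_assoc, hi]
      mul_one := by
        have h₁ : L.X ◁ (η[L.X] ≫ q ≫ i) ≫ μ[L.X] = (ρ_ L.X).hom ≫ q ≫ i := by
          rw [← Iso.inv_comp_eq, h.one_left]
        rw [← cancel_mono i, Category.assoc, Category.assoc, Category.assoc, hm,
          MonoidalCategory.tensorHom_def', Category.assoc, ← whiskerLeft_comp_assoc,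
          Category.assoc, whisker_exchange_assoc, h₁, rightUnitor_naturality_assoc, hi]
      mul_assoc := by
        have h₁ : ((i ⊗ₘ i) ≫ μ[L.X] ≫ q) ▷ X ≫ (i ⊗ₘ i) = ((i ⊗ₘ i) ⊗ₘ i) ≫ μ[L.X] ▷ L.X := by
          rw [← MonoidalCategory.tensorHom_id, ← MonoidalCategory.tensorHom_id,
            MonoidalCategory.tensorHom_comp_tensorHom, MonoidalCategory.tensorHom_comp_tensorHom,
            Category.id_comp, Category.comp_id, Category.assoc, Category.assoc, hm]
        have h₂ : X ◁ ((i ⊗ₘ i) ≫ μ[L.X] ≫ q) ≫ (i ⊗ₘ i) = (i ⊗ₘ (i ⊗ₘ i)) ≫ L.X ◁ μ[L.X] := by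
          rw [← MonoidalCategory.id_tensorHom, ← MonoidalCategory.id_tensorHom,
            MonoidalCategory.tensorHom_comp_tensorHom, MonoidalCategory.tensorHom_comp_tensorHom,
            Category.id_comp, Category.comp_id, Category.assoc, Category.assoc, hm]
        rw [reassoc_of% h₁, reassoc_of% h₂, MonObj.mul_assoc_assoc,
          associator_naturality_assoc] }

/-- The projection onto the image of a central idempotent is a morphism of algebras. -/
@[simps]
def splitProj {L : Mon C} {X : C} (i : X ⟶ L.X) (q : L.X ⟶ X) (hiq : i ≫ q = 𝟙 X)
    (h : IsCentral L (q ≫ i)) : L ⟶ splitAlgebra i q hiq h :=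
  Mon.Hom.mk' q rfl (by
    change μ[L.X] ≫ q = (q ⊗ₘ q) ≫ (i ⊗ₘ i) ≫ μ[L.X] ≫ q
    rw [← Category.assoc (q ⊗ₘ q), MonoidalCategory.tensorHom_comp_tensorHom,
      MonoidalCategory.tensorHom_def, Category.assoc, reassoc_of% h.left, reassoc_of% h.right]
    simp only [hiq, Category.comp_id])

end Split

section OfIdempotents

variable {C : Type u} [Category.{v} C] [MonoidalCategory C] [Preadditive C]
  [IsIdempotentComplete C]

/-- A complete family of central orthogonal idempotents decomposes an algebra as a product. -/
lemma exists_productDecomposition (L : Mon C) {S : Type*} [Fintype S] (e : S → (L.X ⟶ L.X))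
    (he : ∀ s, IsCentral L (e s)) (hee : ∀ s, e s ≫ e s = e s)
    (hne : ∀ s t, s ≠ t → e s ≫ e t = 0) (hsum : ∑ s, e s = 𝟙 L.X) :
    ∃ (L' : S → Mon C) (T : ProductDecomposition L L'), ∀ s, T.e s = e s := by
  choose X i q hiq hqi using fun s => IsIdempotentComplete.idempotents_split L.X (e s) (hee s)
  have hc : ∀ s, IsCentral L (q s ≫ i s) := fun s => by rw [hqi]; exact he s
  refine ⟨fun s => splitAlgebra (i s) (q s) (hiq s) (hc s),
    { p := fun s => splitProj (i s) (q s) (hiq s) (hc s)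
      i := i
      i_p := hiq
      i_p_of_ne := fun {s t} h => ?_
      sum_p_i := (Finset.sum_congr rfl fun s _ => hqi s).trans hsum
      central := hc }, hqi⟩
  have h₁ : i s ≫ e s = i s := by rw [← hqi, reassoc_of% hiq]
  have h₂ : e t ≫ q t = q t := by rw [← hqi, Category.assoc, hiq, Category.comp_id]
  change i s ≫ q t = 0
  rw [← h₁, ← h₂, Category.assoc, reassoc_of% hne s t h, zero_comp, comp_zero]

end OfIdempotents

section Decomposable

variable {C : Type u} [Category.{v} C] [MonoidalCategory C]

/-- An algebra as a right module over itself. -/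
@[simps]
def RightMod.regular (A : Mon C) : RightMod A where
  X := A.X
  act := μ[A.X]
  act_one := MonObj.mul_one A.X
  assoc := by rw [MonObj.mul_assoc, Iso.inv_hom_id_assoc]

/-- The action of a module, as a morphism from a free module. -/
@[simps]
def RightMod.actHom {A : Mon C} (M : RightMod A) : M.X ⊙ₗ regular A ⟶ M where
  hom := M.act
  act_hom := by
    change ((α_ M.X A.X A.X).hom ≫ M.X ◁ μ[A.X]) ≫ M.act = M.act ▷ A.X ≫ M.act
    rw [Category.assoc, M.assoc, Iso.hom_inv_id_assoc]

variable [Preadditive C]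

/-- A central endomorphism of a factor, extended by zero, is central. -/
lemma ProductDecomposition.isCentral_extend {L : Mon C} {S : Type*} [Fintype S] {L' : S → Mon C}
    (T : ProductDecomposition L L') {s : S} {f : (L' s).X ⟶ (L' s).X} (hf : IsCentral (L' s) f) :
    IsCentral L ((T.p s).hom ≫ f ≫ T.i s) := by
  have hg : ((T.p s).hom ≫ f ≫ T.i s) ≫ T.e s = (T.p s).hom ≫ f ≫ T.i s := by
    rw [Category.assoc, Category.assoc, T.i_e]
  constructor
  · have h : μ[L.X] ≫ (T.p s).hom ≫ f ≫ T.i s =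
        (T.e s ⊗ₘ ((T.p s).hom ≫ f ≫ T.i s)) ≫ μ[L.X] := by
      rw [IsMonHom.mul_hom_assoc, ← reassoc_of% hf.left, T.mul_i, ← MonoidalCategory.id_tensorHom,
        MonoidalCategory.tensorHom_comp_tensorHom_assoc,
        MonoidalCategory.tensorHom_comp_tensorHom_assoc, Category.comp_id, Category.assoc]
      rfl
    rw [h, MonoidalCategory.tensorHom_def', Category.assoc, (T.e_central s).right,
      ← (T.e_central s).left, ← whiskerLeft_comp_assoc, hg]
  · have h : μ[L.X] ≫ (T.p s).hom ≫ f ≫ T.i s =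
        (((T.p s).hom ≫ f ≫ T.i s) ⊗ₘ T.e s) ≫ μ[L.X] := by
      rw [IsMonHom.mul_hom_assoc, ← reassoc_of% hf.right, T.mul_i, ← MonoidalCategory.tensorHom_id,
        MonoidalCategory.tensorHom_comp_tensorHom_assoc,
        MonoidalCategory.tensorHom_comp_tensorHom_assoc, Category.comp_id, Category.assoc]
      rfl
    rw [h, MonoidalCategory.tensorHom_def, Category.assoc, (T.e_central s).left,
      ← (T.e_central s).right, ← comp_whiskerRight_assoc, hg]

variable [MonoidalPreadditive C]

/-- If the category of modules over an algebra is decomposable, the algebra has a nontrivial central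
idempotent. -/
lemma exists_central_idempotent (𝕜 : Type w) [Field 𝕜] [Linear 𝕜 C] [MonoidalLinear 𝕜 C]
    (A : Mon C) (hA : ¬ IsIndecomposableAlgebra 𝕜 A) :
    ∃ f : A.X ⟶ A.X, IsCentral A f ∧ f ≫ f = f ∧ f ≠ 0 ∧ f ≠ 𝟙 A.X := by
  obtain ⟨N, _, _, _, _, hN, hn, ⟨Θ⟩⟩ := not_not.1 hA
  let F := Θ.equiv.functor
  have : F.LeftLinear C := Θ.leftLinear
  let P : ∀ Y : ∀ i, N i, Y ⟶ Y := fun Y i => if i = 0 then 𝟙 (Y i) else 0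
  have P0 : ∀ Y, P Y 0 = 𝟙 (Y 0) := fun Y => rfl
  have P1 : ∀ Y, P Y 1 = 0 := fun Y => rfl
  have hP : ∀ {Y Z : ∀ i, N i} (g : Y ⟶ Z), P Y ≫ g = g ≫ P Z := fun {Y Z} g => by
    funext i
    change P Y i ≫ g i = g i ≫ P Z i
    fin_cases i
    · exact (Category.id_comp _).trans (Category.comp_id _).symm
    · exact zero_comp.trans comp_zero.symm
  have hPP : ∀ Y, P Y ≫ P Y = P Y := fun Y => by
    funext i
    change P Y i ≫ P Y i = P Y i
    fin_cases i
    · exact Category.id_comp _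
    · exact zero_comp
  have hPc : ∀ (c : C) (Y : ∀ i, N i), P (c ⊙ₗ Y) = c ⊴ₗ P Y := fun c Y => by
    funext i
    change P (c ⊙ₗ Y) i = c ⊴ₗ P Y i
    fin_cases i
    · exact (MonoidalLeftAction.actionHomRight_id c (Y 0)).symm
    · change 0 = c ⊴ₗ (0 : Y 1 ⟶ Y 1)
      have h := (hN 1).actionHomRight_add c (0 : Y 1 ⟶ Y 1) 0
      rw [add_zero] at h
      exact (left_eq_add.1 h).symm
  let e : ∀ M : RightMod A, M ⟶ M := fun M => F.preimage (P (F.obj M))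
  have he : ∀ M, F.map (e M) = P (F.obj M) := fun M => F.map_preimage _
  have hnat : ∀ {M M' : RightMod A} (g : M ⟶ M'), e M ≫ g = g ≫ e M' := fun g =>
    F.map_injective (by rw [F.map_comp, F.map_comp, he, he, hP])
  have hc : ∀ (c : C) (M : RightMod A), e (c ⊙ₗ M) = c ⊴ₗ e M := fun c M =>
    F.map_injective (by
      rw [he, ← cancel_epi (Functor.LaxLeftLinear.μₗ F c M),
        ← Functor.LaxLeftLinear.μₗ_naturality_right, he, ← hPc, hP])
  let f : A.X ⟶ A.X := (e (RightMod.regular A)).hom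
  have hact : ∀ M : RightMod A, M.X ◁ f ≫ M.act = M.act ≫ (e M).hom := fun M => by
    have h := hnat M.actHom
    rw [hc] at h
    exact congrArg (fun k => RightMod.Hom.hom k) h
  obtain ⟨Y, hY⟩ : ∃ Y : ∀ i, N i, ∀ i, ¬ IsZero (Y i) :=
    ⟨fun i => (hn i).choose, fun i => (hn i).choose_spec⟩
  let M := Θ.equiv.inverse.obj Y
  let c : F.obj M ≅ Y := Θ.equiv.counitIso.app Y
  have hPY : P Y = c.inv ≫ F.map (e M) ≫ c.hom := by rw [he, hP, Iso.inv_hom_id_assoc]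
  refine ⟨f, ⟨hact (RightMod.regular A), (e (RightMod.regular A)).act_hom.symm⟩, ?_, ?_, ?_⟩
  · have h : e (RightMod.regular A) ≫ e (RightMod.regular A) = e (RightMod.regular A) :=
      F.map_injective (by rw [F.map_comp, he, hPP])
    exact congrArg (fun k => RightMod.Hom.hom k) h
  · intro hf
    have h : e M = 0 := RightMod.hom_ext _ _ (M.act_cancel (by
      rw [← hact, hf]; simp))
    have hF : F.Additive := Θ.additive
    have hz : P Y = 0 := by rw [hPY, h, F.map_zero, zero_comp, comp_zero]
    exact hY 0 ((IsZero.iff_id_eq_zero _).2 (congrFun hz 0))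
  · intro hf
    have h : e M = 𝟙 M := RightMod.hom_ext _ _ (M.act_cancel (by
      rw [← hact, hf]; simp))
    have hz : P Y = 𝟙 Y := by rw [hPY, h, F.map_id, Category.id_comp, Iso.inv_hom_id]
    exact hY 1 ((IsZero.iff_id_eq_zero _).2 (congrFun hz 1).symm)

end Decomposable

/-- An algebra in a category with finite-dimensional morphism spaces is a finite product of
algebras without nontrivial central idempotents. -/
lemma exists_indecomposable_productDecomposition (𝕜 : Type w) [Field 𝕜] {C : Type u}
    [Category.{v} C] [Abelian C] [Linear 𝕜 C] [MonoidalCategory C] [MonoidalPreadditive C]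
    [MonoidalLinear 𝕜 C] (hC : ∀ X Y : C, Module.Finite 𝕜 (X ⟶ Y)) (L : Mon C) :
    ∃ (n : ℕ) (L' : Fin n → Mon C) (_ : ProductDecomposition L L'),
      ∀ i, IsIndecomposableAlgebra 𝕜 (L' i) ∧ ¬ IsZero (L' i).X := by
  let R := End (Bimod.regular L)
  let φ : R →ₗ[𝕜] (L.X ⟶ L.X) :=
    { toFun := fun f => f.hom
      map_add' := fun _ _ => rfl
      map_smul' := fun _ _ => rfl }
  have := hC L.X L.X
  have : Module.Finite 𝕜 R :=
    Module.Finite.of_injective φ fun f g h => Bimod.hom_ext _ _ h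
  obtain ⟨s, hs, hprim⟩ := exists_primitive 𝕜 R
  let e : Fin s.card → R := fun i => (s.equivFin.symm i : R)
  have he : ∀ i, e i ∈ s := fun i => (s.equivFin.symm i).2
  have hne : ∀ i j, i ≠ j → e i ≠ e j := fun i j h h' =>
    h (s.equivFin.symm.injective (Subtype.ext h'))
  obtain ⟨L', T, hT⟩ := exists_productDecomposition L (fun i => (e i).hom)
    (fun i => ⟨(e i).left_act_hom.symm, (e i).right_act_hom.symm⟩)
    (fun i => congrArg (fun k : R => Bimod.Hom.hom k) (hs.mul_self _ (he i)))
    (fun i j h => congrArg (fun k : R => Bimod.Hom.hom k)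
      (hs.orthogonal _ (he j) _ (he i) (hne j i h.symm)))
    (by
      have h : ∑ i, e i = 1 := by
        rw [← hs.sum_eq, ← Finset.sum_coe_sort s]
        exact Equiv.sum_comp s.equivFin.symm fun x => (x : R)
      exact ((map_sum φ e Finset.univ).symm.trans (congrArg φ h) :))
  refine ⟨s.card, L', T, fun i => ⟨?_, fun h => ?_⟩⟩
  · by_contra hi
    obtain ⟨f, hf, hff, hf0, hf1⟩ := exists_central_idempotent 𝕜 (L' i) hi
    have hc := T.isCentral_extend hf
    let g : R := ⟨(T.p i).hom ≫ f ≫ T.i i, hc.left.symm, hc.right.symm⟩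
    have hfe : T.i i ≫ ((T.p i).hom ≫ f ≫ T.i i) ≫ (T.p i).hom = f := by
      rw [Category.assoc, Category.assoc, T.i_p, Category.comp_id, reassoc_of% T.i_p]
    have hgg : ((T.p i).hom ≫ f ≫ T.i i) ≫ (T.p i).hom ≫ f ≫ T.i i = (T.p i).hom ≫ f ≫ T.i i := by
      rw [Category.assoc, Category.assoc, reassoc_of% T.i_p, reassoc_of% hff]
    have hge : ((T.p i).hom ≫ f ≫ T.i i) ≫ T.e i = (T.p i).hom ≫ f ≫ T.i i := by
      rw [Category.assoc, Category.assoc, T.i_e]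
    have heg : T.e i ≫ (T.p i).hom ≫ f ≫ T.i i = (T.p i).hom ≫ f ≫ T.i i := (reassoc_of% T.e_p i) _
    rw [hT] at hge heg
    rcases hprim (e i) (he i) g (Bimod.hom_ext _ _ hgg) (Bimod.hom_ext _ _ hge)
      (Bimod.hom_ext _ _ heg) with h | h
    · have h' : (T.p i).hom ≫ f ≫ T.i i = 0 := congrArg (fun k : R => Bimod.Hom.hom k) h
      rw [h', zero_comp, comp_zero] at hfe
      exact hf0 hfe.symm
    · have h' : (T.p i).hom ≫ f ≫ T.i i = T.e i :=
        (congrArg (fun k : R => Bimod.Hom.hom k) h).trans (hT i).symm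
      rw [h', T.e_p, T.i_p] at hfe
      exact hf1 hfe.symm
  · refine hs.ne_zero _ (he i) (Bimod.hom_ext _ _ ?_)
    refine (hT i).symm.trans (?_ : (T.p i).hom ≫ T.i i = 0)
    rw [h.eq_of_tgt (T.p i).hom 0, zero_comp]

end FinTens

theorem mainTheorem10
    (𝕜 : Type*) [Field 𝕜] [IsAlgClosed 𝕜] [CharZero 𝕜]
    (C : Type*) [Category* C] [Abelian C] [Linear 𝕜 C] [MonoidalCategory C] [RigidCategory C]
    [MonoidalPreadditive C] [FinTens.IsFiniteTensorCategory 𝕜 C]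
    (L : Mon C) (hL : FinTens.IsExactAlgebra L) :
    ∃ (n : ℕ) (L' : Fin n → Mon C) (p : ∀ i, L ⟶ L' i),
      -- `L` is the product of the algebras `L' i`, with projections `p i`
      Nonempty (IsLimit (Fan.mk L p)) ∧
      (∀ i, FinTens.IsExactAlgebra (L' i) ∧ FinTens.IsIndecomposableAlgebra 𝕜 (L' i) ∧
        ¬ IsZero (L' i).X) ∧
      -- the module category of right `L`-modules decomposes
      Nonempty (FinTens.ModuleEquivalence 𝕜 C (FinTens.RightMod L)
        (∀ i, FinTens.RightMod (L' i))) ∧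
      -- the multitensor category of `L`-bimodules decomposes
      ∃ Φ : Bimod L L ≌ (∀ ij : Fin n × Fin n, Bimod (L' ij.1) (L' ij.2)),
        FinTens.IsBimodDecomposition 𝕜 p Φ := by
  obtain ⟨n, L', T, hT⟩ := FinTens.exists_indecomposable_productDecomposition 𝕜
    (FinTens.IsFiniteTensorCategory.finite (𝕜 := 𝕜) (C := C)).finite_hom L
  exact ⟨n, L', T.p, ⟨T.isLimitFan⟩, fun i => ⟨T.isExactAlgebra hL i, hT i⟩,
    ⟨T.moduleEquivalence 𝕜⟩, T.bimodBlocks.equivalence, T.isBimodDecomposition 𝕜⟩
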